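/- Let $k$ be an algebraically closed field. For $a,b,c\in k$ put $$\Delta(a,b,c)=256\,(-256+80b^2ac-18ba^3c-18ac^3b-b^2a^2c^2+6a^2c^2-144c^2b+4a^3c^3+4b^3a^2+4b^3c^2+128b^2-144ba^2+192ac-16b^4+27c^4+27a^4)^2,$$ the discriminant of $X^8+aX^6+bX^4+cX^2+1$, and $$\mathfrak s_2=ac,\qquad \mathfrak s_3=(a^2+c^2)\,b,\qquad \mathfrak s_4=a^4+c^4 .$$ For a function field $K/k$ of one variable, an elliptic involution of $\mathrm{Aut}(K/k)$ is an involution whose fixed field has genus $1$. If $K$ is hyperelliptic, of characteristic other than $2$, with hyperelliptic involution $\zeta_0$, its reduced automorphism group is $\overline{\mathrm{Aut}}(K)=\mathrm{Aut}(K/k)/\langle\zeta_0\rangle$, and an elliptic involution of $\overline{\mathrm{Aut}}(K)$ is an involution that is the image of an elliptic involution of $\mathrm{Aut}(K/k)$. For hyperelliptic $K,K'$ of genus $3$ and elliptic involutions $\varepsilon\in\overline{\mathrm{Aut}}(K)$, $\varepsilon'\in\overline{\mathrm{Aut}}(K')$, the pairs $(K,\varepsilon)$ and $(K',\varepsilon')$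 are isomorphic if there is a $k$-isomorphism $\alpha:K\to K'$ with $\varepsilon'=\alpha\varepsilon\alpha^{-1}$. (1) If $\Delta(a,b,c)\neq0$, then the equation $$Y^2=X^8+aX^6+bX^4+cX^2+1$$ defines a hyperelliptic field $K_{a,b,c}=k(X,Y)$ of genus $3$ (with $X$ transcendental over $k$). Its reduced automorphism group contains a (non-hyperelliptic) elliptic involution $\varepsilon_{a,b,c}:X\mapsto-X$; it is the class of the automorphism $X\mapsto -X$, $Y\mapsto Y$, and an automorphism $\sigma$ of $K_{a,b,c}/k$ has class $\varepsilon_{a,b,c}$ if and only if $\sigma(X)=-X$. (2) Let $\Delta(a,b,c)\ne0$ and $\Delta(a',b',c')\neq0$, and let $\mathfrak s_i$ and $\mathfrak s_i'$ be the invariants of $(a,b,c)$ and $(a',b',c')$. If $(K_{a,b,c},\varepsilon_{a,b,c})$ and $(K_{a',b',c'},\varepsilon_{a',b',c'})$ are isomorphic, then $\mathfrak s_2=\mathfrak s_2'$, $\mathfrak s_3=\mathfrak s_3'$ and $\mathfrak s_4=\mathfrak s_4'$. If moreover $\mathfrak s_4+2\mathfrak s_2^2\neq0$, then the two pairs are isomorphic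 if and only if $\mathfrak s_2=\mathfrak s_2'$, $\mathfrak s_3=\mathfrak s_3'$ and $\mathfrak s_4=\mathfrak s_4'$. -/

import Mathlib

open Polynomial
open scoped KaehlerDifferential IntermediateField

universe u

noncomputable section

namespace DihedralInvariants

/-! ### Function fields of one variable, their genus, and hyperelliptic fields -/

/-- `K / k` is a function field of one variable: a finite extension of `k(x)` for some
`x` transcendental over `k`. -/
def IsFunctionField (k K : Type u) [Field k] [Field K] [Algebra k K] : Prop :=
  ∃ x : K, Transcendental k x ∧ FiniteDimensional k⟮x⟯ K

/-- The differentials of `K / k` which are regular at the valuation ring `O` of `K / k`: the image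
of `Ω[O⁄k]` in `Ω[K⁄k]`, that is, the finite sums of `f dg` with `f, g ∈ O`. -/
def differentialsRegularAt (k : Type u) {K : Type u} [Field k] [Field K] [Algebra k K]
    (O : ValuationSubring K) : Submodule k Ω[K⁄k] :=
  Submodule.span k {ω | ∃ f ∈ O, ∃ g ∈ O, ω = f • KaehlerDifferential.D k K g}

/-- The everywhere regular differentials of `K / k`: those which are regular at all valuation
rings of `K` that contain `k`. -/
def regularDifferentials (k K : Type u) [Field k] [Field K] [Algebra k K] :
    Submodule k Ω[K⁄k] :=
  ⨅ (O : ValuationSubring K) (_ : ∀ r : k, algebraMap k K r ∈ O), differentialsRegularAt k O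

/-- The genus of a function field `K` of one variable over an algebraically closed field `k`:
the dimension over `k` of the space of everywhere regular differentials. -/
def genus (k K : Type u) [Field k] [Field K] [Algebra k K] : Cardinal.{u} :=
  Module.rank k (regularDifferentials k K)

/-- The subfield `F` of `K / k` is a rational function field `k(x)`. -/
def IsRationalSubfield {k K : Type u} [Field k] [Field K] [Algebra k K]
    (F : IntermediateField k K) : Prop :=
  ∃ x : K, Transcendental k x ∧ F = k⟮x⟯

/-- `K / k` is a hyperelliptic field: a function field of one variable of genus at least `2` which
is of degree `2` over a rational subfield. -/
def IsHyperellipticField (k K : Type u) [Field k] [Field K] [Algebra k K] : Prop :=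
  IsFunctionField k K ∧ 2 ≤ genus k K ∧
    ∃ F : IntermediateField k K, IsRationalSubfield F ∧ Module.finrank F K = 2

/-! ### Involutions and the reduced automorphism group -/

/-- The fixed field of an automorphism of `K / k`. -/
def fixedSubfield {k K : Type u} [Field k] [Field K] [Algebra k K] (σ : K ≃ₐ[k] K) :
    IntermediateField k K :=
  IntermediateField.fixedField (Subgroup.zpowers σ)

/-- A hyperelliptic involution of `K / k`: an involution whose fixed field is rational. -/
def IsHyperellipticInvolution {k K : Type u} [Field k] [Field K] [Algebra k K]
    (σ : K ≃ₐ[k] K) : Prop :=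
  orderOf σ = 2 ∧ IsRationalSubfield (fixedSubfield σ)

/-- An elliptic involution of `K / k`: an involution whose fixed field has genus `1`. -/
def IsEllipticInvolution {k K : Type u} [Field k] [Field K] [Algebra k K]
    (σ : K ≃ₐ[k] K) : Prop :=
  orderOf σ = 2 ∧ genus k (fixedSubfield σ) = 1

/-- The subgroup of `Aut(K/k)` generated by the hyperelliptic involution. (A hyperelliptic field
of characteristic other than `2` has exactly one hyperelliptic involution, and it is central.) -/
def hyperellipticSubgroup (k K : Type u) [Field k] [Field K] [Algebra k K] :
    Subgroup (K ≃ₐ[k] K) :=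
  Subgroup.normalClosure {σ | IsHyperellipticInvolution σ}

instance (k K : Type u) [Field k] [Field K] [Algebra k K] :
    (hyperellipticSubgroup k K).Normal :=
  Subgroup.normalClosure_normal

/-- The reduced automorphism group of `K / k`: the quotient of `Aut(K/k)` by the subgroup
generated by the hyperelliptic involution. -/
abbrev ReducedAut (k K : Type u) [Field k] [Field K] [Algebra k K] : Type u :=
  (K ≃ₐ[k] K) ⧸ hyperellipticSubgroup k K

/-- The class of an automorphism in the reduced automorphism group. -/
def toReduced {k K : Type u} [Field k] [Field K] [Algebra k K] (σ : K ≃ₐ[k] K) :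
    ReducedAut k K :=
  QuotientGroup.mk σ

/-- An elliptic involution of the reduced automorphism group: an involution which is the image of
an elliptic involution of `Aut(K/k)`. -/
def IsReducedEllipticInvolution {k K : Type u} [Field k] [Field K] [Algebra k K]
    (ε : ReducedAut k K) : Prop :=
  orderOf ε = 2 ∧ ∃ σ : K ≃ₐ[k] K, IsEllipticInvolution σ ∧ toReduced σ = ε

section Transport

variable {k K L : Type u} [Field k] [Field K] [Algebra k K] [Field L] [Algebra k L]

theorem fixedSubfield_autCongr (α : K ≃ₐ[k] L) (σ : K ≃ₐ[k] K) :
    fixedSubfield (AlgEquiv.autCongr α σ) = (fixedSubfield σ).map (α : K →ₐ[k] L) := by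
  have key : ∀ {M : Type u} [Field M] [Algebra k M] (τ : M ≃ₐ[k] M) (x : M),
      x ∈ fixedSubfield τ ↔ τ x = x := by
    intro M _ _ τ x
    unfold fixedSubfield
    rw [IntermediateField.mem_fixedField_iff]
    constructor
    · intro h
      exact h τ (Subgroup.mem_zpowers τ)
    · intro h f hf
      have hle : Subgroup.zpowers τ ≤ MulAction.stabilizer (M ≃ₐ[k] M) x := by
        rw [Subgroup.zpowers_le]
        exact h
      exact hle hf
  ext y
  rw [key, IntermediateField.mem_map]
  constructor
  · intro h
    refine ⟨α.symm y, (key _ _).2 ?_, by simp⟩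
    apply α.injective
    simpa using h
  · rintro ⟨x, hx, rfl⟩
    have := (key _ _).1 hx
    simp [this]

theorem isRationalSubfield_map (α : K ≃ₐ[k] L) {F : IntermediateField k K}
    (hF : IsRationalSubfield F) : IsRationalSubfield (F.map (α : K →ₐ[k] L)) := by
  obtain ⟨x, hx, rfl⟩ := hF
  refine ⟨α x, ?_, ?_⟩
  · exact fun halg => hx ((isAlgebraic_algHom_iff (α : K →ₐ[k] L) α.injective).1 halg)
  · rw [IntermediateField.adjoin_map]
    simp

theorem isHyperellipticInvolution_autCongr (α : K ≃ₐ[k] L) {σ : K ≃ₐ[k] K}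
    (hσ : IsHyperellipticInvolution σ) : IsHyperellipticInvolution (AlgEquiv.autCongr α σ) := by
  refine ⟨?_, ?_⟩
  · rw [MulEquiv.orderOf_eq]
    exact hσ.1
  · rw [fixedSubfield_autCongr]
    exact isRationalSubfield_map α hσ.2

theorem map_hyperellipticSubgroup (α : K ≃ₐ[k] L) :
    (hyperellipticSubgroup k K).map (AlgEquiv.autCongr α).toMonoidHom =
      hyperellipticSubgroup k L := by
  have hset : (AlgEquiv.autCongr α).toMonoidHom '' {σ | IsHyperellipticInvolution σ} =
      {σ | IsHyperellipticInvolution σ} := by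
    ext τ
    constructor
    · rintro ⟨σ, hσ, rfl⟩
      exact isHyperellipticInvolution_autCongr α hσ
    · intro hτ
      refine ⟨AlgEquiv.autCongr α.symm τ, isHyperellipticInvolution_autCongr α.symm hτ, ?_⟩
      exact (AlgEquiv.autCongr α).apply_symm_apply τ
  unfold hyperellipticSubgroup
  rw [Subgroup.map_normalClosure _ _ (AlgEquiv.autCongr α).surjective, hset]

/-- Conjugation by an isomorphism `α : K → L` over `k`, on reduced automorphism groups: it sends
the class of `σ` to the class of `α σ α⁻¹`. -/
def reducedAutCongr (α : K ≃ₐ[k] L) : ReducedAut k K ≃* ReducedAut k L :=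
  QuotientGroup.congr _ _ (AlgEquiv.autCongr α) (map_hyperellipticSubgroup α)

theorem reducedAutCongr_toReduced (α : K ≃ₐ[k] L) (σ : K ≃ₐ[k] K) :
    reducedAutCongr α (toReduced σ) = toReduced ((α.symm.trans σ).trans α) :=
  rfl

end Transport

/-- The pairs `(K, ε)` and `(L, δ)` are isomorphic: there is an isomorphism `α : K → L` over `k`
with `δ = α ε α⁻¹`. -/
def PairIso {k K L : Type u} [Field k] [Field K] [Algebra k K] [Field L] [Algebra k L]
    (ε : ReducedAut k K) (δ : ReducedAut k L) : Prop :=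
  ∃ α : K ≃ₐ[k] L, δ = reducedAutCongr α ε

/-! ### The field `K_{a,b,c}` -/

section Curve

variable {k : Type u} [Field k]

/-- The discriminant `Δ` of `X ^ 8 + a X ^ 6 + b X ^ 4 + c X ^ 2 + 1`. -/
def Δ (a b c : k) : k :=
  256 * (-256 + 80 * b ^ 2 * a * c - 18 * b * a ^ 3 * c - 18 * a * c ^ 3 * b
    - b ^ 2 * a ^ 2 * c ^ 2 + 6 * a ^ 2 * c ^ 2 - 144 * c ^ 2 * b + 4 * a ^ 3 * c ^ 3
    + 4 * b ^ 3 * a ^ 2 + 4 * b ^ 3 * c ^ 2 + 128 * b ^ 2 - 144 * b * a ^ 2 + 192 * a * c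
    - 16 * b ^ 4 + 27 * c ^ 4 + 27 * a ^ 4) ^ 2

/-- The octic `X ^ 8 + a X ^ 6 + b X ^ 4 + c X ^ 2 + 1`. -/
def octic (a b c : k) : k[X] :=
  X ^ 8 + C a * X ^ 6 + C b * X ^ 4 + C c * X ^ 2 + 1

/-- The polynomial `Y ^ 2 - (X ^ 8 + a X ^ 6 + b X ^ 4 + c X ^ 2 + 1)` over `k(X)`. -/
def definingPoly (a b c : k) : (RatFunc k)[X] :=
  X ^ 2 - C (algebraMap k[X] (RatFunc k) (octic a b c))

theorem octic_not_square (a b c : k) (h : Δ a b c ≠ 0) (g : k[X]) : g ^ 2 ≠ octic a b c := by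
  intro hg
  have h2 : (2 : k) ≠ 0 := by
    intro h2
    apply h
    have : (256 : k) = 2 * 128 := by norm_num
    unfold Δ
    rw [this, h2]
    ring
  have hdeg : (octic a b c).natDegree = 8 := by
    unfold octic
    compute_degree!
  have hg4 : g.natDegree = 4 := by
    have := congrArg natDegree hg
    rw [natDegree_pow, hdeg] at this
    omega
  have hsum : g = C (g.coeff 0) + C (g.coeff 1) * X + C (g.coeff 2) * X ^ 2
      + C (g.coeff 3) * X ^ 3 + C (g.coeff 4) * X ^ 4 := by
    conv_lhs => rw [g.as_sum_range_C_mul_X_pow, hg4]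
    simp [Finset.sum_range_succ]
  generalize g.coeff 0 = p0 at hsum
  generalize g.coeff 1 = p1 at hsum
  generalize g.coeff 2 = p2 at hsum
  generalize g.coeff 3 = p3 at hsum
  generalize g.coeff 4 = p4 at hsum
  have hexp : g ^ 2 = C (p0 ^ 2) + C (2 * p0 * p1) * X + C (2 * p0 * p2 + p1 ^ 2) * X ^ 2
      + C (2 * p0 * p3 + 2 * p1 * p2) * X ^ 3 + C (2 * p0 * p4 + 2 * p1 * p3 + p2 ^ 2) * X ^ 4
      + C (2 * p1 * p4 + 2 * p2 * p3) * X ^ 5 + C (2 * p2 * p4 + p3 ^ 2) * X ^ 6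
      + C (2 * p3 * p4) * X ^ 7 + C (p4 ^ 2) * X ^ 8 := by
    rw [hsum]
    simp only [map_add, map_mul, map_pow, map_ofNat]
    ring
  rw [hexp] at hg
  unfold octic at hg
  have e0 := congrArg (fun q => coeff q 0) hg
  have e1 := congrArg (fun q => coeff q 1) hg
  have e2 := congrArg (fun q => coeff q 2) hg
  have e4 := congrArg (fun q => coeff q 4) hg
  have e6 := congrArg (fun q => coeff q 6) hg
  have e7 := congrArg (fun q => coeff q 7) hg
  have e8 := congrArg (fun q => coeff q 8) hg
  simp [coeff_X, coeff_one, coeff_C, coeff_X_pow, -map_add, -map_mul, -map_pow]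
    at e0 e1 e2 e4 e6 e7 e8
  have n0 : p0 ≠ 0 := by
    rintro rfl
    simp at e0
  have n4 : p4 ≠ 0 := by
    rintro rfl
    simp at e8
  have z3 : p3 = 0 := by
    simpa [h2, n4] using e7
  have z1 : p1 = 0 := by
    simpa [h2, n0] using e1
  subst z1 z3
  apply h
  unfold Δ
  have ha : a = 2 * p2 * p4 := by linear_combination -e6
  have hb : b = 2 * p0 * p4 + p2 ^ 2 := by linear_combination -e4
  have hc : c = 2 * p0 * p2 := by linear_combination -e2
  have h0 : p0 = 1 ∨ p0 = -1 := by
    simpa using e0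
  have h4 : p4 = 1 ∨ p4 = -1 := by
    simpa using e8
  rw [ha, hb, hc]
  rcases h0 with rfl | rfl <;> rcases h4 with rfl | rfl <;> ring

theorem definingPoly_irreducible (a b c : k) (h : Δ a b c ≠ 0) :
    Irreducible (definingPoly a b c) := by
  apply X_pow_sub_C_irreducible_of_prime Nat.prime_two
  intro r hr
  have hint : IsIntegral k[X] r := by
    refine IsIntegral.of_pow (n := 2) (by norm_num) ?_
    rw [hr]
    exact isIntegral_algebraMap
  obtain ⟨g, rfl⟩ := IsIntegrallyClosed.isIntegral_iff.1 hint
  rw [← map_pow] at hr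
  exact octic_not_square a b c h g (IsFractionRing.injective k[X] (RatFunc k) hr)

/-- The field `K_{a,b,c} = k(X, Y)` with `Y ^ 2 = X ^ 8 + a X ^ 6 + b X ^ 4 + c X ^ 2 + 1`, as a
quadratic extension of `k(X)`. -/
def CurveField (a b c : k) (_h : Δ a b c ≠ 0) : Type u :=
  AdjoinRoot (definingPoly a b c)

instance (a b c : k) (h : Δ a b c ≠ 0) : Field (CurveField a b c h) :=
  haveI : Fact (Irreducible (definingPoly a b c)) := ⟨definingPoly_irreducible a b c h⟩
  inferInstanceAs (Field (AdjoinRoot (definingPoly a b c)))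

instance (a b c : k) (h : Δ a b c ≠ 0) : Algebra k (CurveField a b c h) :=
  inferInstanceAs (Algebra k (AdjoinRoot (definingPoly a b c)))

/-- The element `X` of `K_{a,b,c}`. -/
def genX (a b c : k) (h : Δ a b c ≠ 0) : CurveField a b c h :=
  AdjoinRoot.of (definingPoly a b c) RatFunc.X

/-- The element `Y` of `K_{a,b,c}`. -/
def genY (a b c : k) (h : Δ a b c ≠ 0) : CurveField a b c h :=
  AdjoinRoot.root (definingPoly a b c)

/-- The automorphism `X ↦ -X` of `k(X)`. -/
def negX (k : Type u) [Field k] : RatFunc k ≃ₐ[k] RatFunc k :=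
  AlgEquiv.ofRingEquiv
    (f := IsFractionRing.ringEquivOfRingEquiv (algEquivAevalNegX (R := k)).toRingEquiv)
    (by
      intro r
      rw [IsScalarTower.algebraMap_apply k k[X] (RatFunc k),
        IsFractionRing.ringEquivOfRingEquiv_algebraMap]
      congr 1
      exact (algEquivAevalNegX (R := k)).commutes r)

theorem negX_algebraMap (p : k[X]) :
    negX k (algebraMap k[X] (RatFunc k) p) = algebraMap k[X] (RatFunc k) (aeval (-X) p) := by
  change IsFractionRing.ringEquivOfRingEquiv (algEquivAevalNegX (R := k)).toRingEquiv _ = _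
  simp

theorem definingPoly_map_negX (a b c : k) :
    (definingPoly a b c).map (negX k : RatFunc k →+* RatFunc k) = definingPoly a b c := by
  have h : aeval (-X) (octic a b c) = octic a b c := by
    simp only [octic, map_add, map_mul, map_pow, aeval_X, aeval_C, map_one, algebraMap_eq]
    ring
  have h' := negX_algebraMap (octic a b c)
  rw [h] at h'
  simp [definingPoly, h']

/-- The automorphism `X ↦ -X`, `Y ↦ Y` of `K_{a,b,c}`. -/
def negXAut (a b c : k) (h : Δ a b c ≠ 0) : CurveField a b c h ≃ₐ[k] CurveField a b c h :=
  (AdjoinRoot.mapAlgEquiv (negX k) (definingPoly a b c) (definingPoly a b c)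
    (by rw [definingPoly_map_negX]) :
      AdjoinRoot (definingPoly a b c) ≃ₐ[k] AdjoinRoot (definingPoly a b c))

theorem negXAut_genX (a b c : k) (h : Δ a b c ≠ 0) :
    negXAut a b c h (genX a b c h) = -genX a b c h := by
  have hX : negX k RatFunc.X = -RatFunc.X := by
    have := negX_algebraMap (X : k[X])
    simpa using this
  have hof : negXAut a b c h (genX a b c h) =
      AdjoinRoot.of (definingPoly a b c) (negX k RatFunc.X) :=
    AdjoinRoot.map_of (negX k : RatFunc k →+* RatFunc k) (definingPoly a b c)
      (definingPoly a b c) (by rw [definingPoly_map_negX]) RatFunc.X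
  rw [hof, hX, map_neg]
  rfl

theorem negXAut_genY (a b c : k) (h : Δ a b c ≠ 0) :
    negXAut a b c h (genY a b c h) = genY a b c h :=
  AdjoinRoot.map_root (negX k : RatFunc k →+* RatFunc k) (definingPoly a b c)
    (definingPoly a b c) (by rw [definingPoly_map_negX])

/-- The element `ε_{a,b,c} : X ↦ -X` of the reduced automorphism group of `K_{a,b,c}`. -/
def epsilon (a b c : k) (h : Δ a b c ≠ 0) : ReducedAut k (CurveField a b c h) :=
  toReduced (negXAut a b c h)

/-- The dihedral invariant `𝔰₂ = a c`. -/
def s2 (a _b c : k) : k := a * c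

/-- The dihedral invariant `𝔰₃ = (a² + c²) b`. -/
def s3 (a b c : k) : k := (a ^ 2 + c ^ 2) * b

/-- The dihedral invariant `𝔰₄ = a⁴ + c⁴`. -/
def s4 (a _b c : k) : k := a ^ 4 + c ^ 4

end Curve

end DihedralInvariants

end

open DihedralInvariants

/-!
Let `K = k(x, w)` with `w ^ 2 = d(x)`, `d` squarefree and `char k ≠ 2`. Everything rests on an
explicit description of the regular differentials of `K`. The module `Ω[K⁄k]` is free on `dx / w`.
At a valuation ring containing `x`, the identity `u d + v d' = 1` gives
`dx / w = u w dx + 2 v dw`, so `dx / w` is regular there (`coord_symm_mem_differentialsRegularAt`).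
Conversely the derivation `w d/dx` preserves the ring `k[x] + k[x] w`, which is the integral closure
of `k[x]` and hence a Dedekind ring, as well as its localizations; so a regular differential is
`f dx / w` with `f ∈ k[x] + k[x] w` (`exists_coord_eq`). The same two facts for the generators
`x⁻¹` and `w / x ^ (m + 1)` show that the regular differentials are the `p(x) dx / w` with
`deg p < m` (`mem_regularDifferentials_iff`). This gives genus `3` for `K_{a,b,c}`, and genus `1` for
the fixed field `k(X ^ 2, Y)` of `X ↦ -X`, `Y ↦ Y`.

An involution whose fixed field is rational acts as `-1` on the regular differentials, since there
are no regular differentials on `k(u)` (`kaehlerTransport_eq_neg`). So it fixes the quotient `X` of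
`X dX / Y` and `dX / Y`: the hyperelliptic involution is unique, and the subgroup it generates is
the stabilizer of `X`.

An isomorphism `K_{a',b',c'} → K_{a,b,c}` maps regular differentials to regular differentials, so it
maps `X'` to a quotient of polynomials of degree at most `1` in `X` (`exists_linear_fraction`). If it
respects the elliptic involutions, that quotient is odd in `X`, so it is `l X` or `l X⁻¹`, and a
comparison of the two octics relates the coefficients through `m = l ^ 2`, a fourth root of unity
(`pairIso_iff_exists_related`). The invariants do not change under these relations, and determine
the coefficients up to them when `𝔰₄ + 2 𝔰₂ ^ 2 = (a ^ 2 + c ^ 2) ^ 2` does not vanish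
(`exists_related_of_invariants_eq`).
-/

namespace DihedralInvariants

/-! ### Quadratic extensions of a rational function field -/

theorem two_ne_zero_of_algebra {k : Type u} (K : Type u) [Field k] [Field K] [Algebra k K]
    (h2 : (2 : k) ≠ 0) : (2 : K) ≠ 0 := by
  rw [← map_ofNat (algebraMap k K)]
  exact (_root_.map_ne_zero _).2 h2

/-- Division of a pair of polynomials by its greatest common divisor. -/
theorem exists_isCoprime_factors {k : Type u} [Field k] (p q : k[X]) (h : q ≠ 0) :
    ∃ g p' q' : k[X], g ≠ 0 ∧ IsCoprime p' q' ∧ p = g * p' ∧ q = g * q' := by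
  classical
  have hg : EuclideanDomain.gcd p q ≠ 0 := fun h0 => h (EuclideanDomain.gcd_eq_zero_iff.1 h0).2
  obtain ⟨p', hp⟩ := EuclideanDomain.gcd_dvd_left p q
  obtain ⟨q', hq⟩ := EuclideanDomain.gcd_dvd_right p q
  refine ⟨_, p', q', hg, ⟨EuclideanDomain.gcdA p q, EuclideanDomain.gcdB p q,
    mul_left_cancel₀ hg ?_⟩, hp, hq⟩
  have hb := EuclideanDomain.gcd_eq_gcd_ab p q
  linear_combination -hb - EuclideanDomain.gcdA p q * hp - EuclideanDomain.gcdB p q * hq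

/-- A rational function `q / r` for which `(q / r) ^ 2 * d` is a polynomial, with `d` squarefree,
is itself a polynomial. -/
theorem dvd_of_sq_dvd_sq_mul_squarefree {k : Type u} [Field k] {d q r : k[X]}
    (hd : Squarefree d) (h : r ^ 2 ∣ q ^ 2 * d) : r ∣ q := by
  by_cases hr : r = 0
  · subst hr
    rw [zero_pow two_ne_zero, zero_dvd_iff, mul_eq_zero] at h
    rcases h with h | h
    · simp [pow_eq_zero_iff two_ne_zero |>.1 h]
    · exact absurd h hd.ne_zero
  obtain ⟨g, q', r', hg, hcop, rfl, rfl⟩ := exists_isCoprime_factors q r hr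
  have h1 : r' ^ 2 ∣ q' ^ 2 * d := by
    rw [mul_pow, mul_pow, mul_assoc] at h
    exact (mul_dvd_mul_iff_left (pow_ne_zero 2 hg)).1 h
  have h3 : r' * r' ∣ d := by
    rw [← pow_two]
    exact (hcop.symm.pow).dvd_of_dvd_mul_left h1
  exact mul_dvd_mul_left g ((hd r' h3).dvd)

/-- A presentation of `K / k` as a quadratic extension `k(x)(w)` of a rational function field,
with `w ^ 2 = d(x)` for a squarefree polynomial `d`, together with its conjugation `w ↦ -w`. -/
structure QuadraticModel (k K : Type u) [Field k] [Field K] [Algebra k K] where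
  /-- the generator of the rational subfield -/
  x : K
  /-- the square root -/
  w : K
  /-- the radicand -/
  d : k[X]
  /-- the conjugation over `k(x)` -/
  conj : K →ₐ[k] K
  transcendental_x : Transcendental k x
  squarefree_d : Squarefree d
  sq_w : w ^ 2 = aeval x d
  conj_x : conj x = x
  conj_w : conj w = -w
  exists_repr : ∀ z : K, ∃ p q r : k[X], r ≠ 0 ∧ aeval x r * z = aeval x p + aeval x q * w

namespace QuadraticModel

variable {k K : Type u} [Field k] [Field K] [Algebra k K] (M : QuadraticModel k K)

theorem aeval_injective : Function.Injective (aeval M.x : k[X] →ₐ[k] K) :=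
  transcendental_iff_injective.1 M.transcendental_x

theorem aeval_ne_zero {p : k[X]} (hp : p ≠ 0) : aeval M.x p ≠ 0 :=
  fun h => hp (M.aeval_injective (by simpa using h))

theorem conj_aeval (p : k[X]) : M.conj (aeval M.x p) = aeval M.x p := by
  rw [← aeval_algHom_apply, M.conj_x]

theorem w_ne_zero : M.w ≠ 0 := by
  intro h
  have := M.sq_w
  rw [h, zero_pow two_ne_zero] at this
  exact M.aeval_ne_zero M.squarefree_d.ne_zero this.symm

/-- An element of `K` which is integral over `k[x]` lies in `k[x] + k[x] w`. -/
theorem exists_eq_add_of_isIntegral (h2 : (2 : k) ≠ 0) {z : K}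
    (hz : (aeval M.x : k[X] →ₐ[k] K).toRingHom.IsIntegralElem z) :
    ∃ p q : k[X], z = aeval M.x p + aeval M.x q * M.w := by
  have h2K := two_ne_zero_of_algebra K h2
  let : Algebra k[X] K := (aeval M.x : k[X] →ₐ[k] K).toAlgebra
  have halg : ∀ p : k[X], algebraMap k[X] K p = aeval M.x p := fun _ => rfl
  have hz' : IsIntegral k[X] z := hz
  let τ : K →ₐ[k[X]] K := { M.conj with commutes' := fun p => M.conj_aeval p }
  have hτ : ∀ y, τ y = M.conj y := fun _ => rfl
  have hcz : IsIntegral k[X] (M.conj z) := hz'.map τ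
  have hw : IsIntegral k[X] M.w := by
    refine IsIntegral.of_pow (n := 2) (by norm_num) ?_
    rw [M.sq_w]
    exact isIntegral_algebraMap (R := k[X]) (x := M.d)
  obtain ⟨p, q, r, hr, hrep⟩ := M.exists_repr z
  have hr' := M.aeval_ne_zero hr
  have hrepc : aeval M.x r * M.conj z = aeval M.x p - aeval M.x q * M.w := by
    have := congrArg M.conj hrep
    simpa [M.conj_aeval, M.conj_w, sub_eq_add_neg] using this
  -- an integral element `s / r` of `k(x)` is a polynomial
  have key : ∀ s : k[X], ∀ y : K, IsIntegral k[X] y → aeval M.x r * y = aeval M.x s → r ∣ s := by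
    intro s y hy hys
    have : FaithfulSMul k[X] K := (faithfulSMul_iff_algebraMap_injective _ _).2 M.aeval_injective
    let : Algebra (FractionRing k[X]) K := FractionRing.liftAlgebra k[X] K
    have := FractionRing.isScalarTower_liftAlgebra k[X] K
    have hyf : y = algebraMap (FractionRing k[X]) K
        (algebraMap k[X] (FractionRing k[X]) s / algebraMap k[X] (FractionRing k[X]) r) := by
      rw [map_div₀, ← IsScalarTower.algebraMap_apply, ← IsScalarTower.algebraMap_apply, halg, halg,
        eq_div_iff hr', mul_comm, hys]
    rw [hyf] at hy
    have hy' := (isIntegral_algebraMap_iff (algebraMap (FractionRing k[X]) K).injective).1 hy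
    obtain ⟨t, ht⟩ := IsIntegrallyClosed.isIntegral_iff.1 hy'
    refine ⟨t, ?_⟩
    apply IsFractionRing.injective k[X] (FractionRing k[X])
    rw [map_mul, ht, mul_div_cancel₀]
    exact (map_ne_zero_iff _ (IsFractionRing.injective k[X] (FractionRing k[X]))).2 hr
  have hC2 : IsUnit (C (2 : k)) := (isUnit_iff_ne_zero.2 h2).map C
  have hp : r ∣ p := by
    have := key (C 2 * p) (z + M.conj z) (hz'.add hcz) (by
      rw [map_mul, aeval_C, map_ofNat]; linear_combination hrep + hrepc)
    exact hC2.dvd_mul_left.1 this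
  have hq : r ∣ q := by
    apply dvd_of_sq_dvd_sq_mul_squarefree M.squarefree_d
    have hI : IsIntegral k[X] (((z - M.conj z) * M.w)) := (hz'.sub hcz).mul hw
    have h1 := key (C 2 * (q * M.d)) _ hI (by
      rw [map_mul, map_mul, aeval_C, map_ofNat, ← M.sq_w]
      linear_combination M.w * hrep - M.w * hrepc)
    obtain ⟨t, ht⟩ := hC2.dvd_mul_left.1 h1
    have hI2 : IsIntegral k[X] ((z - M.conj z) ^ 2) := (hz'.sub hcz).pow 2
    have h3 := key (C 2 * C 2 * (q * t)) _ hI2 (by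
      have ht' := congrArg (aeval M.x) ht
      rw [map_mul, map_mul, ← M.sq_w] at ht'
      simp only [map_mul, map_ofNat]
      apply mul_left_cancel₀ hr'
      have e : aeval M.x r * (z - M.conj z) = 2 * aeval M.x q * M.w := by
        linear_combination hrep - hrepc
      linear_combination (aeval M.x r * (z - M.conj z) + 2 * aeval M.x q * M.w) * e
        + 4 * aeval M.x q * ht')
    obtain ⟨s, hs⟩ := (hC2.mul hC2).dvd_mul_left.1 h3
    exact ⟨s, by linear_combination q * ht + r * hs⟩
  obtain ⟨p', rfl⟩ := hp
  obtain ⟨q', rfl⟩ := hq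
  refine ⟨p', q', mul_left_cancel₀ hr' ?_⟩
  rw [hrep, map_mul, map_mul]
  ring

/-- `K` is separable over the fraction field of `k[x]`. -/
theorem isSeparable (h2 : (2 : k) ≠ 0) :
    let : Algebra k[X] K := (aeval M.x : k[X] →ₐ[k] K).toAlgebra
    have : FaithfulSMul k[X] K := (faithfulSMul_iff_algebraMap_injective _ _).2 M.aeval_injective
    let : Algebra (FractionRing k[X]) K := FractionRing.liftAlgebra k[X] K
    Algebra.IsSeparable (FractionRing k[X]) K := by
  intro _ _ _
  have halg : ∀ p : k[X], algebraMap k[X] K p = aeval M.x p := fun _ => rfl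
  have := FractionRing.isScalarTower_liftAlgebra k[X] K
  let F := FractionRing k[X]
  have hFalg : ∀ p : k[X], algebraMap F K (algebraMap k[X] F p) = aeval M.x p := fun p => by
    rw [← IsScalarTower.algebraMap_apply, halg]
  have hw : IsSeparable F M.w := by
    have hd : algebraMap k[X] F M.d ≠ 0 :=
      (map_ne_zero_iff _ (IsFractionRing.injective k[X] F)).2 M.squarefree_d.ne_zero
    have h2F : ((2 : ℕ) : F) ≠ 0 := by
      rw [Nat.cast_ofNat, ← map_ofNat (algebraMap k F)]
      exact (_root_.map_ne_zero _).2 h2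
    refine (separable_X_pow_sub_C _ h2F hd).of_dvd (minpoly.dvd F M.w ?_)
    simp [hFalg, M.sq_w]
  refine ⟨fun z => by
    obtain ⟨p, q, r, hr, hrep⟩ := M.exists_repr z
    have hr' := M.aeval_ne_zero hr
    have : z = algebraMap F K (algebraMap k[X] F p / algebraMap k[X] F r) +
        algebraMap F K (algebraMap k[X] F q / algebraMap k[X] F r) * M.w := by
      simp only [map_div₀, hFalg]
      field_simp
      linear_combination hrep
    rw [this]
    exact Field.isSeparable_add (isSeparable_algebraMap _)
      (Field.isSeparable_mul (isSeparable_algebraMap _) hw)⟩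

/-- `Ω[K⁄k]` is free over `K` on `dx`: the étale extension `K` of `k[x]` has no more differentials
than `k[x]` itself. -/
theorem exists_linearEquiv_D_x (h2 : (2 : k) ≠ 0) : ∃ e : Ω[K⁄k] ≃ₗ[K] K,
    e (KaehlerDifferential.D k K M.x) = 1 := by
  let : Algebra k[X] K := (aeval M.x : k[X] →ₐ[k] K).toAlgebra
  have halg : ∀ p : k[X], algebraMap k[X] K p = aeval M.x p := fun _ => rfl
  have : IsScalarTower k k[X] K := IsScalarTower.of_algebraMap_eq fun r => by
    rw [halg, Polynomial.algebraMap_eq, aeval_C]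
  have : FaithfulSMul k[X] K := (faithfulSMul_iff_algebraMap_injective _ _).2 M.aeval_injective
  let : Algebra (FractionRing k[X]) K := FractionRing.liftAlgebra k[X] K
  have := FractionRing.isScalarTower_liftAlgebra k[X] K
  let F := FractionRing k[X]
  have hsep : Algebra.IsSeparable F K := M.isSeparable h2
  have : Algebra.FormallyEtale k[X] F :=
    Algebra.FormallyEtale.of_isLocalization (nonZeroDivisors k[X])
  have : Algebra.FormallyEtale F K := Algebra.FormallyEtale.of_isSeparable F K
  have : Algebra.FormallyEtale k[X] K := Algebra.FormallyEtale.comp k[X] F K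
  let e := (KaehlerDifferential.tensorKaehlerEquivOfFormallyEtale k k[X] K).symm ≪≫ₗ
    (KaehlerDifferential.polynomialEquiv k).baseChange k[X] K _ _ ≪≫ₗ
      TensorProduct.AlgebraTensorModule.rid k[X] K K
  refine ⟨e, ?_⟩
  have hx : M.x = algebraMap k[X] K X := by rw [halg, aeval_X]
  simp only [e, LinearEquiv.trans_apply]
  rw [hx, KaehlerDifferential.tensorKaehlerEquivOfFormallyEtale_symm_D_algebraMap]
  simp

end QuadraticModel

/-! ### Differentials and the genus of a quadratic model -/

/-- A polynomial in `x` which is `x ^ m` times a polynomial in `x⁻¹` has degree at most `m`. -/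
theorem natDegree_le_of_aeval_eq {k K : Type u} [Field k] [Field K] [Algebra k K] {x : K}
    (hx : Transcendental k x) {p q : k[X]} {m : ℕ}
    (h : aeval x p = x ^ m * aeval x⁻¹ q) : p.natDegree ≤ m := by
  have hx0 : x ≠ 0 := fun h0 => hx (h0 ▸ isAlgebraic_zero)
  by_cases hp : p = 0
  · simp [hp]
  let := invertibleOfNonzero (inv_ne_zero hx0)
  have hrev := eval₂_reflect_mul_pow (algebraMap k K) x⁻¹ q.natDegree q le_rfl
  rw [invOf_eq_inv, inv_inv] at hrev
  have h1 : aeval x (p * X ^ q.natDegree) = aeval x (X ^ m * reflect q.natDegree q) := by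
    simp only [map_mul, map_pow, aeval_X]
    rw [h, aeval_def x⁻¹, ← hrev, aeval_def x, inv_pow]
    field_simp
  have h2 := congrArg natDegree (transcendental_iff_injective.1 hx h1)
  rw [natDegree_mul_X_pow (hp := hp)] at h2
  have h3 : (X ^ m * reflect q.natDegree q).natDegree ≤ m + q.natDegree :=
    natDegree_mul_le.trans (add_le_add (natDegree_X_pow_le m)
      (natDegree_reflect_le.trans (by simp)))
  omega

namespace QuadraticModel

variable {k K : Type u} [Field k] [Field K] [Algebra k K] (M : QuadraticModel k K)

theorem x_ne_zero : M.x ≠ 0 := fun h0 =>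
  M.transcendental_x (h0 ▸ isAlgebraic_zero)

/-- Comparison of coefficients in `K = k(x) ⊕ k(x) w`, for coefficients fixed by the
conjugation. -/
theorem eq_and_eq_of_add_eq (h2 : (2 : k) ≠ 0) {a b a' b' : K} (ha : M.conj a = a)
    (hb : M.conj b = b) (ha' : M.conj a' = a') (hb' : M.conj b' = b')
    (h : a + b * M.w = a' + b' * M.w) : a = a' ∧ b = b' := by
  have h2K := two_ne_zero_of_algebra K h2
  have hc := congrArg M.conj h
  simp only [map_add, map_mul, ha, hb, ha', hb', M.conj_w] at hc
  constructor
  · apply mul_left_cancel₀ h2K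
    linear_combination h + hc
  · apply mul_left_cancel₀ h2K
    apply mul_right_cancel₀ M.w_ne_zero
    linear_combination h - hc

theorem exists_coord (h2 : (2 : k) ≠ 0) : ∃ e : Ω[K⁄k] ≃ₗ[K] K,
    e (KaehlerDifferential.D k K M.x) = M.w := by
  obtain ⟨e, he⟩ := M.exists_linearEquiv_D_x h2
  refine ⟨e ≪≫ₗ LinearEquiv.smulOfNeZero K K M.w M.w_ne_zero, ?_⟩
  simp [he]

/-- The coordinate of a differential with respect to the basis `dx / w` of `Ω[K⁄k]`. -/
noncomputable def coord (h2 : (2 : k) ≠ 0) : Ω[K⁄k] ≃ₗ[K] K :=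
  (M.exists_coord h2).choose

theorem coord_D_x (h2 : (2 : k) ≠ 0) : M.coord h2 (KaehlerDifferential.D k K M.x) = M.w :=
  (M.exists_coord h2).choose_spec

theorem coord_D_aeval (h2 : (2 : k) ≠ 0) (p : k[X]) :
    M.coord h2 (KaehlerDifferential.D k K (aeval M.x p)) = aeval M.x (derivative p) * M.w := by
  rw [Derivation.map_aeval, map_smul, coord_D_x, smul_eq_mul]

theorem two_mul_coord_D_w (h2 : (2 : k) ≠ 0) :
    2 * M.coord h2 (KaehlerDifferential.D k K M.w) = aeval M.x (derivative M.d) := by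
  have h := M.coord_D_aeval h2 M.d
  rw [← M.sq_w, pow_two, Derivation.leibniz, map_add, map_smul, smul_eq_mul] at h
  apply mul_right_cancel₀ M.w_ne_zero
  linear_combination h

/-- At a valuation ring centred at a maximal ideal of the ring `k[x] + k[x] w` of integral
elements, the regular differentials have integral coordinate: the derivation `w d/dx` preserves
that ring and hence its localizations. A differential which is regular at all of them therefore
has a coordinate in `k[x] + k[x] w`. -/
theorem exists_coord_eq (h2 : (2 : k) ≠ 0) {ω : Ω[K⁄k]} (hω : ω ∈ regularDifferentials k K) :
    ∃ p q : k[X], M.coord h2 ω = aeval M.x p + aeval M.x q * M.w := by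
  let δ : Derivation k K K :=
    ((M.coord h2 : Ω[K⁄k] ≃ₗ[K] K) : Ω[K⁄k] →ₗ[K] K).compDer (KaehlerDifferential.D k K)
  have hδ : ∀ g, δ g = M.coord h2 (KaehlerDifferential.D k K g) := fun _ => rfl
  let : Algebra k[X] K := (aeval M.x : k[X] →ₐ[k] K).toAlgebra
  have halg : ∀ p : k[X], algebraMap k[X] K p = aeval M.x p := fun _ => rfl
  have : FaithfulSMul k[X] K := (faithfulSMul_iff_algebraMap_injective _ _).2 M.aeval_injective
  let : Algebra (FractionRing k[X]) K := FractionRing.liftAlgebra k[X] K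
  have := FractionRing.isScalarTower_liftAlgebra k[X] K
  let F := FractionRing k[X]
  have hFalg : ∀ p : k[X], algebraMap F K (algebraMap k[X] F p) = aeval M.x p := fun p => by
    rw [← IsScalarTower.algebraMap_apply, halg]
  have hsep := M.isSeparable h2
  have hfin : FiniteDimensional F K := by
    classical
    refine ⟨⟨({1, M.w} : Finset K), ?_⟩⟩
    rw [eq_top_iff]
    rintro z -
    obtain ⟨p, q, r, hr, hrep⟩ := M.exists_repr z
    have hr' := M.aeval_ne_zero hr
    rw [Finset.coe_pair, Submodule.mem_span_pair]
    refine ⟨algebraMap k[X] F p / algebraMap k[X] F r,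
      algebraMap k[X] F q / algebraMap k[X] F r, ?_⟩
    simp only [Algebra.smul_def, map_div₀, hFalg]
    field_simp
    linear_combination -hrep
  have : IsDedekindDomain (integralClosure k[X] K) := integralClosure.isDedekindDomain k[X] F K
  have : IsFractionRing (integralClosure k[X] K) K :=
    integralClosure.isFractionRing_of_finite_extension F K
  have hint : ∀ z : integralClosure k[X] K, ∃ p q : k[X],
      (z : K) = aeval M.x p + aeval M.x q * M.w :=
    fun z => M.exists_eq_add_of_isIntegral h2 z.2
  have hwint : IsIntegral k[X] M.w := by
    refine IsIntegral.of_pow (n := 2) (by norm_num) ?_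
    rw [M.sq_w]
    exact isIntegral_algebraMap (R := k[X]) (x := M.d)
  have hpint : ∀ p : k[X], IsIntegral k[X] (aeval M.x p) := fun p =>
    isIntegral_algebraMap (R := k[X]) (x := p)
  have hδint : ∀ z : K, IsIntegral k[X] z → IsIntegral k[X] (δ z) := by
    intro z hz
    obtain ⟨p, q, rfl⟩ := hint ⟨z, hz⟩
    have hw : δ M.w = aeval M.x (C (2⁻¹ : k) * derivative M.d) := by
      apply mul_left_cancel₀ (two_ne_zero_of_algebra K h2)
      rw [hδ, M.two_mul_coord_D_w h2, map_mul, aeval_C, map_inv₀, map_ofNat, ← mul_assoc,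
        mul_inv_cancel₀ (two_ne_zero_of_algebra K h2), one_mul]
    have hp : ∀ p : k[X], δ (aeval M.x p) = aeval M.x (derivative p) * M.w :=
      fun p => M.coord_D_aeval h2 p
    rw [map_add, Derivation.leibniz, hp, hp, hw, smul_eq_mul, smul_eq_mul]
    exact ((hpint _).mul hwint).add (((hpint _).mul (hpint _)).add (hwint.mul ((hpint _).mul hwint)))
  suffices h : M.coord h2 ω ∈ (algebraMap (integralClosure k[X] K) K).range by
    obtain ⟨z, hz⟩ := h
    obtain ⟨p, q, hpq⟩ := hint z
    exact ⟨p, q, by rw [← hz]; exact hpq⟩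
  refine IsDedekindDomain.HeightOneSpectrum.mem_integers_of_valuation_le_one K _ fun v => ?_
  set O := (v.valuation K).valuationSubring with hO
  have hmemO : ∀ z, z ∈ O ↔ v.valuation K z ≤ 1 := fun z => Iff.rfl
  have hOint : ∀ z : K, IsIntegral k[X] z → z ∈ O := fun z hz =>
    v.valuation_le_one (⟨z, hz⟩ : integralClosure k[X] K)
  have hkO : ∀ r : k, algebraMap k K r ∈ O := fun r => by
    apply hOint
    simpa using hpint (C r)
  have hδO : ∀ g ∈ O, δ g ∈ O := by
    intro g hg
    obtain ⟨a, b, hab⟩ := v.exists_primeCompl_mul_eq_of_integer g hg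
    have hb1 : v.valuation K ((b : integralClosure k[X] K) : K) = 1 :=
      (v.valuation_eq_one_iff_notMem (K := K)).2 b.2
    have hb0 : ((b : integralClosure k[X] K) : K) ≠ 0 := fun h0 => by simp [h0] at hb1
    have hbinv : ((b : integralClosure k[X] K) : K)⁻¹ ∈ O := by
      rw [hmemO, map_inv₀, hb1, inv_one]
    -- the quotient rule for `g = a / b`, with `b` a unit of `O`
    have hD : δ g = ((b : integralClosure k[X] K) : K)⁻¹ *
        (δ a - g * δ (b : integralClosure k[X] K)) := by
      have hab' : g * ((b : integralClosure k[X] K) : K) = a := hab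
      rw [← hab', Derivation.leibniz, smul_eq_mul, smul_eq_mul]
      field_simp
      ring
    rw [hD]
    exact O.mul_mem _ _ hbinv (O.sub_mem (hOint _ (hδint _ a.2))
      (O.mul_mem _ _ hg (hOint _ (hδint _ b.1.2))))
  have hωO : ω ∈ differentialsRegularAt k O := by
    have := hω
    simp only [regularDifferentials, Submodule.mem_iInf] at this
    exact this O hkO
  rw [← hmemO]
  refine Submodule.span_induction (p := fun η _ => M.coord h2 η ∈ O) ?_ ?_ ?_ ?_ hωO
  · rintro _ ⟨f, hf, g, hg, rfl⟩
    rw [map_smul, smul_eq_mul]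
    exact O.mul_mem _ _ hf (hδO g hg)
  · rw [map_zero]; exact O.zero_mem
  · intro a b _ _ ha hb
    rw [map_add]; exact O.add_mem _ _ ha hb
  · intro r a _ ha
    rw [← algebraMap_smul K r a, map_smul, smul_eq_mul]
    exact O.mul_mem _ _ (hkO r) ha

/-- A combination `u d + v d' = 1` writes the basis differential `dx / w` as `u w dx + 2 v dw`. -/
theorem coord_symm_mem_differentialsRegularAt [IsAlgClosed k] (h2 : (2 : k) ≠ 0)
    {O : ValuationSubring K} (hk : ∀ r : k, algebraMap k K r ∈ O) (hx : M.x ∈ O)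
    {f : K} (hf : f ∈ O) : (M.coord h2).symm f ∈ differentialsRegularAt k O := by
  have hp : ∀ p : k[X], aeval M.x p ∈ O := by
    intro p
    induction p using Polynomial.induction_on' with
    | add p q hp hq => rw [map_add]; exact O.add_mem _ _ hp hq
    | monomial n a => rw [aeval_monomial]; exact O.mul_mem _ _ (hk a) (pow_mem hx n)
  have hw : M.w ∈ O := by
    rw [← O.valuation_le_one_iff] 
    have := (O.valuation_le_one_iff _).2 (hp M.d)
    rw [← M.sq_w, map_pow] at this
    exact (pow_le_one_iff two_ne_zero).1 this
  obtain ⟨u, v, huv⟩ := (PerfectField.separable_iff_squarefree.2 M.squarefree_d)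
  have key : (M.coord h2).symm f = (f * (aeval M.x u * M.w)) • KaehlerDifferential.D k K M.x +
      (f * (2 * aeval M.x v)) • KaehlerDifferential.D k K M.w := by
    rw [LinearEquiv.symm_apply_eq, map_add, map_smul, map_smul, M.coord_D_x, smul_eq_mul,
      smul_eq_mul]
    have h1 := congrArg (aeval M.x) huv
    rw [map_add, map_mul, map_mul, ← M.sq_w, ← M.two_mul_coord_D_w h2, map_one] at h1
    linear_combination -f * h1
  rw [key]
  have h2O : (2 : K) ∈ O := by rw [← map_ofNat (algebraMap k K)]; exact hk 2
  refine add_mem (Submodule.subset_span ⟨_, ?_, _, hx, rfl⟩)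
    (Submodule.subset_span ⟨_, ?_, _, hw, rfl⟩)
  · exact O.mul_mem _ _ hf (O.mul_mem _ _ (hp u) hw)
  · exact O.mul_mem _ _ hf (O.mul_mem _ _ h2O (hp v))

section Genus

/-- Comparison of the coordinates for the generators `x, w` and `x⁻¹, w / x ^ n` of `K`. -/
theorem x_sq_mul_coord (h2 : (2 : k) ≠ 0) (M' : QuadraticModel k K) {n : ℕ} (hx : M'.x = M.x⁻¹)
    (hw : M'.w * M.x ^ n = M.w) (ω : Ω[K⁄k]) :
    M.x ^ 2 * M.coord h2 ω = -(M.x ^ n * M'.coord h2 ω) := by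
  obtain ⟨f, rfl⟩ : ∃ f : K, ω = f • KaehlerDifferential.D k K M'.x :=
    ⟨M'.coord h2 ω / M'.w, (M'.coord h2).injective (by
      rw [map_smul, M'.coord_D_x, smul_eq_mul, div_mul_cancel₀ _ M'.w_ne_zero])⟩
  have hx0 := M.x_ne_zero
  have hD : M.coord h2 (KaehlerDifferential.D k K M'.x) = -(M.x⁻¹ ^ 2 * M.w) := by
    rw [hx, Derivation.leibniz_inv, map_smul, M.coord_D_x, smul_eq_mul]
    ring
  rw [map_smul, map_smul, hD, M'.coord_D_x, smul_eq_mul, smul_eq_mul, ← hw]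
  field_simp

/-- The everywhere regular differentials are the `p(x) dx / w` with `p` of degree less than `m`, if
both `w ^ 2` and `(w / x ^ (m + 1)) ^ 2` are squarefree polynomials, in `x` and in `x⁻¹`
respectively. -/
theorem mem_regularDifferentials_iff [IsAlgClosed k] (h2 : (2 : k) ≠ 0) (M' : QuadraticModel k K)
    {m : ℕ} (hx : M'.x = M.x⁻¹) (hw : M'.w * M.x ^ (m + 1) = M.w) (ω : Ω[K⁄k]) :
    ω ∈ regularDifferentials k K ↔ ∃ p ∈ degreeLT k m, M.coord h2 ω = aeval M.x p := by
  have hx0 := M.x_ne_zero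
  have hcoord := M.x_sq_mul_coord h2 M' hx hw ω
  constructor
  · intro hω
    obtain ⟨p, q, hpq⟩ := M.exists_coord_eq h2 hω
    obtain ⟨p', q', hpq'⟩ := M'.exists_coord_eq h2 hω
    have hc : ∀ r, M.conj (aeval M'.x r) = aeval M'.x r := fun r => by
      rw [← aeval_algHom_apply, hx, map_inv₀, M.conj_x]
    rw [hpq, hpq'] at hcoord
    obtain ⟨h1, h3⟩ := M.eq_and_eq_of_add_eq h2 (a := M.x ^ 2 * aeval M.x p)
      (b := M.x ^ 2 * aeval M.x q) (a' := -(M.x ^ (m + 1) * aeval M'.x p'))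
      (b' := -aeval M'.x q') (by simp [M.conj_aeval, M.conj_x]) (by simp [M.conj_aeval, M.conj_x])
      (by simp [hc, M.conj_x]) (by simp [hc])
      (by rw [← hw] at hcoord ⊢; linear_combination hcoord)
    have hq : q = 0 := by
      by_contra hq
      have := natDegree_le_of_aeval_eq M.transcendental_x (p := q * X ^ 2) (q := -q') (m := 0) (by
        rw [← hx, map_mul, map_pow, aeval_X, map_neg, mul_comm, h3, pow_zero, one_mul])
      rw [natDegree_mul_X_pow (hp := hq)] at this
      omega
    refine ⟨p, ?_, by rw [hpq, hq]; simp⟩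
    by_cases hp : p = 0
    · rw [hp]; exact zero_mem _
    have := natDegree_le_of_aeval_eq M.transcendental_x (p := p * X ^ 2) (q := -p') (m := m + 1) (by
        rw [← hx, map_mul, map_pow, aeval_X, map_neg, mul_comm, h1, mul_neg])
    rw [natDegree_mul_X_pow (hp := hp)] at this
    rw [mem_degreeLT, degree_eq_natDegree hp]
    exact_mod_cast (by omega : p.natDegree < m)
  · rintro ⟨p, hp, hpω⟩
    simp only [regularDifferentials, Submodule.mem_iInf]
    intro O hk
    have hO : ∀ (y : K) (p : k[X]), y ∈ O → aeval y p ∈ O := by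
      intro y p hy
      induction p using Polynomial.induction_on' with
      | add p q hp hq => rw [map_add]; exact O.add_mem _ _ hp hq
      | monomial n a => rw [aeval_monomial]; exact O.mul_mem _ _ (hk a) (pow_mem hy n)
    rcases O.mem_or_inv_mem M.x with hxO | hxO
    · rw [← (M.coord h2).symm_apply_apply ω, hpω]
      exact M.coord_symm_mem_differentialsRegularAt h2 hk hxO (hO _ _ hxO)
    · rw [← hx] at hxO
      rw [← (M'.coord h2).symm_apply_apply ω]
      refine M'.coord_symm_mem_differentialsRegularAt h2 hk hxO ?_
      by_cases hp0 : p = 0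
      · rw [hpω, hp0, map_zero, mul_zero, eq_comm, neg_eq_zero, mul_eq_zero,
          or_iff_right (pow_ne_zero _ hx0)] at hcoord
        rw [hcoord]
        exact O.zero_mem
      have hdeg : p.natDegree < m := by
        rw [mem_degreeLT, degree_eq_natDegree hp0] at hp
        exact_mod_cast hp
      obtain ⟨l, rfl⟩ : ∃ l, m = l + 1 := ⟨m - 1, by omega⟩
      let := invertibleOfNonzero hx0
      have hrev := eval₂_reflect_mul_pow (algebraMap k K) M.x l p (by omega)
      rw [invOf_eq_inv, ← hx, ← aeval_def, ← aeval_def] at hrev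
      have : M'.coord h2 ω = -aeval M'.x (reflect l p) := by
        apply mul_left_cancel₀ (pow_ne_zero (l + 1 + 1) hx0)
        rw [hpω, ← hrev] at hcoord
        linear_combination hcoord
      rw [this]
      exact O.neg_mem _ (hO _ _ hxO)

/-- If both `w ^ 2` and `(w / x ^ (m + 1)) ^ 2` are squarefree polynomials, in `x` and in `x⁻¹`
respectively, then `K` has genus `m`. -/
theorem genus_eq [IsAlgClosed k] (h2 : (2 : k) ≠ 0) (M' : QuadraticModel k K)
    {m : ℕ} (hx : M'.x = M.x⁻¹) (hw : M'.w * M.x ^ (m + 1) = M.w) :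
    genus k K = m := by
  let f : k[X] →ₗ[k] Ω[K⁄k] :=
    ((M.coord h2).symm.toLinearMap.restrictScalars k) ∘ₗ (aeval M.x).toLinearMap
  have hf : Function.Injective f := (M.coord h2).symm.injective.comp M.aeval_injective
  have hreg : regularDifferentials k K = (degreeLT k m).map f := by
    ext ω
    rw [M.mem_regularDifferentials_iff h2 M' hx hw, Submodule.mem_map]
    refine exists_congr fun p => and_congr_right fun _ => ?_
    change _ ↔ (M.coord h2).symm (aeval M.x p) = ω
    rw [LinearEquiv.symm_apply_eq, eq_comm]
  rw [genus, hreg, ← (Submodule.equivMapOfInjective f hf _).rank_eq,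
    (degreeLTEquiv k m).rank_eq, rank_fin_fun]

end Genus
end QuadraticModel

/-! ### Involutions with rational fixed field -/

section Transport

variable {k K L : Type u} [Field k] [Field K] [Algebra k K] [Field L] [Algebra k L]

theorem exists_kaehlerTransport (α : K →ₐ[k] L) : ∃ φ : Ω[K⁄k] →+ Ω[L⁄k],
    (∀ (f : K) (ω : Ω[K⁄k]), φ (f • ω) = α f • φ ω) ∧
    ∀ g : K, φ (KaehlerDifferential.D k K g) = KaehlerDifferential.D k L (α g) := by
  let : Algebra K L := α.toRingHom.toAlgebra
  have : IsScalarTower k K L := IsScalarTower.of_algebraMap_eq fun r => (α.commutes r).symm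
  refine ⟨(KaehlerDifferential.map k k K L).toAddMonoidHom, fun f ω => ?_, fun g => ?_⟩
  · exact (KaehlerDifferential.map k k K L).map_smul f ω
  · exact KaehlerDifferential.map_D k k K L g

/-- The map on differentials induced by an embedding of fields, `f dg ↦ α(f) dα(g)`. -/
noncomputable def kaehlerTransport (α : K →ₐ[k] L) : Ω[K⁄k] →+ Ω[L⁄k] :=
  (exists_kaehlerTransport α).choose

theorem kaehlerTransport_smul (α : K →ₐ[k] L) (f : K) (ω : Ω[K⁄k]) :
    kaehlerTransport α (f • ω) = α f • kaehlerTransport α ω :=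
  (exists_kaehlerTransport α).choose_spec.1 f ω

theorem kaehlerTransport_D (α : K →ₐ[k] L) (g : K) :
    kaehlerTransport α (KaehlerDifferential.D k K g) = KaehlerDifferential.D k L (α g) :=
  (exists_kaehlerTransport α).choose_spec.2 g

theorem kaehlerTransport_mem_regularDifferentials (α : K ≃ₐ[k] L) {ω : Ω[K⁄k]}
    (hω : ω ∈ regularDifferentials k K) :
    kaehlerTransport (α : K →ₐ[k] L) ω ∈ regularDifferentials k L := by
  simp only [regularDifferentials, Submodule.mem_iInf] at hω ⊢
  intro O hO
  have h := hω (O.comap (α : K →+* L)) (fun r => by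
    rw [ValuationSubring.mem_comap]
    simpa using hO r)
  refine Submodule.span_induction
    (p := fun η _ => kaehlerTransport (α : K →ₐ[k] L) η ∈ differentialsRegularAt k O) ?_ ?_ ?_ ?_ h
  · rintro _ ⟨f, hf, g, hg, rfl⟩
    rw [kaehlerTransport_smul, kaehlerTransport_D]
    exact Submodule.subset_span ⟨_, hf, _, hg, rfl⟩
  · rw [map_zero]; exact zero_mem _
  · intro a b _ _ ha hb
    rw [map_add]; exact add_mem ha hb
  · intro r a _ ha
    rw [← algebraMap_smul K r a, kaehlerTransport_smul, AlgHom.commutes, algebraMap_smul]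
    exact Submodule.smul_mem _ _ ha

theorem kaehlerTransport_comp_eq_self (α : K →ₐ[k] L) (β : L →ₐ[k] K) (h : ∀ z, β (α z) = z)
    (ω : Ω[K⁄k]) : kaehlerTransport β (kaehlerTransport α ω) = ω := by
  have hω : ω ∈ Submodule.span K (Set.range (KaehlerDifferential.D k K)) := by
    rw [KaehlerDifferential.span_range_derivation]; trivial
  refine Submodule.span_induction
    (p := fun η _ => kaehlerTransport β (kaehlerTransport α η) = η) ?_ ?_ ?_ ?_ hω
  · rintro _ ⟨g, rfl⟩
    rw [kaehlerTransport_D, kaehlerTransport_D, h]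
  · rw [map_zero, map_zero]
  · intro a b _ _ ha hb
    rw [map_add, map_add, ha, hb]
  · intro f a _ ha
    rw [kaehlerTransport_smul, kaehlerTransport_smul, h, ha]

end Transport

variable {k K : Type u} [Field k] [Field K] [Algebra k K]

theorem mem_fixedSubfield_iff (σ : K ≃ₐ[k] K) (x : K) : x ∈ fixedSubfield σ ↔ σ x = x := by
  unfold fixedSubfield
  rw [IntermediateField.mem_fixedField_iff]
  constructor
  · intro h
    exact h σ (Subgroup.mem_zpowers σ)
  · intro h f hf
    have hle : Subgroup.zpowers σ ≤ MulAction.stabilizer (K ≃ₐ[k] K) x := by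
      rw [Subgroup.zpowers_le]
      exact h
    exact hle hf

theorem exists_sq_mul_squarefree (f : k[X]) (hf : f ≠ 0) :
    ∃ s d : k[X], f = s ^ 2 * d ∧ Squarefree d := by
  induction hn : f.natDegree using Nat.strong_induction_on generalizing f with
  | _ n ih =>
    by_cases hsq : Squarefree f
    · exact ⟨1, f, by simp, hsq⟩
    · simp only [Squarefree, not_forall] at hsq
      obtain ⟨a, ⟨g, rfl⟩, ha⟩ := hsq
      have ha0 : a ≠ 0 := by rintro rfl; simp at hf
      have hg0 : g ≠ 0 := by rintro rfl; simp at hf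
      have hdeg : 0 < a.natDegree :=
        natDegree_pos_iff_degree_pos.2 (degree_pos_of_ne_zero_of_nonunit ha0 ha)
      rw [natDegree_mul (mul_ne_zero ha0 ha0) hg0, natDegree_mul ha0 ha0] at hn
      obtain ⟨s, d, rfl, hd⟩ := ih g.natDegree (by omega) g hg0 rfl
      exact ⟨a * s, d, by ring, hd⟩

theorem exists_div_of_mem_adjoin_simple {u z : K} (hz : z ∈ k⟮u⟯) :
    ∃ p r : k[X], aeval u r ≠ 0 ∧ aeval u r * z = aeval u p := by
  obtain ⟨p, r, rfl⟩ := IntermediateField.mem_adjoin_simple_iff k z |>.1 hz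
  by_cases hr : aeval u r = 0
  · exact ⟨0, 1, by simp, by simp [hr]⟩
  · exact ⟨p, r, hr, mul_div_cancel₀ _ hr⟩

/-- An involution whose fixed field is `k(u)` is the conjugation of a quadratic model of `K` over
`k(u)`. -/
theorem exists_quadraticModel (h2 : (2 : k) ≠ 0) {σ : K ≃ₐ[k] K} (hσ : orderOf σ = 2) {u : K}
    (hu : Transcendental k u) (hfix : fixedSubfield σ = k⟮u⟯) :
    ∃ M : QuadraticModel k K, M.x = u ∧ M.conj = σ := by
  have hσσ : ∀ z, σ (σ z) = z := by
    intro z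
    have := DFunLike.congr_fun (pow_orderOf_eq_one σ) z
    rwa [hσ, pow_two] at this
  have hmem : ∀ z, σ z = z → ∃ p r : k[X], aeval u r ≠ 0 ∧ aeval u r * z = aeval u p := by
    intro z hz
    rw [← mem_fixedSubfield_iff, hfix] at hz
    exact exists_div_of_mem_adjoin_simple hz
  have hσu : σ u = u := by
    rw [← mem_fixedSubfield_iff, hfix]
    exact IntermediateField.mem_adjoin_simple_self k u
  have hσp : ∀ p : k[X], σ (aeval u p) = aeval u p := fun p => by
    have := aeval_algHom_apply (σ : K →ₐ[k] K) u p
    simpa [hσu] using this.symm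
  obtain ⟨z, hz⟩ : ∃ z, σ z ≠ z := by
    by_contra! h
    have : σ = 1 := AlgEquiv.ext h
    rw [this, orderOf_one] at hσ
    omega
  have hz' : z - σ z ≠ 0 := sub_ne_zero.2 hz.symm
  obtain ⟨p, r, hr, hpr⟩ := hmem ((z - σ z) ^ 2) (by rw [map_pow, map_sub, hσσ]; ring)
  have hp : aeval u p ≠ 0 := by rw [← hpr]; exact mul_ne_zero hr (pow_ne_zero 2 hz')
  have hne : ∀ p : k[X], p ≠ 0 → aeval u p ≠ 0 := fun p hp h => hp
    (transcendental_iff_injective.1 hu (by simpa using h))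
  have hrp : r * p ≠ 0 := by
    intro h0
    have := congrArg (aeval u) h0
    rw [map_mul, map_zero] at this
    exact mul_ne_zero hr hp this
  obtain ⟨s, d, hsd, hd⟩ := exists_sq_mul_squarefree (r * p) hrp
  have hs : aeval u s ≠ 0 := by
    refine hne s ?_
    rintro rfl
    rw [hsd] at hrp
    simp at hrp
  -- `(z - σ z) ^ 2 = p / r`, and `r p = s ^ 2 d`
  set w := aeval u r * (z - σ z) / aeval u s with hw
  have hw0 : w ≠ 0 := div_ne_zero (mul_ne_zero hr hz') hs
  have hσw : σ w = -w := by
    rw [hw, map_div₀, map_mul, map_sub, hσσ, hσp, hσp]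
    ring
  refine ⟨⟨u, w, d, σ, hu, hd, ?_, hσu, hσw, fun y => ?_⟩, rfl, rfl⟩
  · have h := congrArg (aeval u) hsd
    simp only [map_mul, map_pow] at h
    rw [hw, div_pow, div_eq_iff (pow_ne_zero 2 hs), mul_pow]
    linear_combination h + aeval u r * hpr
  -- `2 y = (y + σ y) + ((y - σ y) / w) w` with invariant coefficients
  · obtain ⟨p1, r1, hr1, h1⟩ := hmem (y + σ y) (by rw [map_add, hσσ]; ring)
    obtain ⟨p2, r2, hr2, h2'⟩ := hmem ((y - σ y) / w) (by
      rw [map_div₀, map_sub, hσσ, hσw, div_neg, ← neg_div, neg_sub])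
    have h22 : (C (2 : k)) ≠ 0 := C_ne_zero.2 h2
    refine ⟨p1 * r2, p2 * r1, C 2 * r1 * r2, ?_, ?_⟩
    · refine mul_ne_zero (mul_ne_zero h22 ?_) ?_ <;> rintro rfl <;> simp at hr1 hr2
    · rw [mul_div_assoc', div_eq_iff hw0] at h2'
      simp only [map_mul, map_ofNat]
      linear_combination aeval u r2 * h1 + aeval u r1 * h2'

/-- The quotient by an involution with rational fixed field has no regular differentials, so the
involution acts as `-1` on the regular differentials: an invariant regular differential is
`q(u) du` with a polynomial `q`, and the same holds for `u⁻¹` in place of `u`. -/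
theorem kaehlerTransport_eq_neg (h2 : (2 : k) ≠ 0) {σ : K ≃ₐ[k] K}
    (hσ : IsHyperellipticInvolution σ) {ω : Ω[K⁄k]} (hω : ω ∈ regularDifferentials k K) :
    kaehlerTransport (σ : K →ₐ[k] K) ω = -ω := by
  obtain ⟨hord, u, hu, hfix⟩ := hσ
  have hσσ : ∀ z, σ (σ z) = z := by
    intro z
    have := DFunLike.congr_fun (pow_orderOf_eq_one σ) z
    rwa [hord, pow_two] at this
  set φ := kaehlerTransport (σ : K →ₐ[k] K) with hφ
  set η := ω + φ ω with hη
  have hφη : φ η = η := by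
    rw [hη, map_add, hφ, kaehlerTransport_comp_eq_self _ _ hσσ, add_comm]
  have hreg : η ∈ regularDifferentials k K :=
    add_mem hω (kaehlerTransport_mem_regularDifferentials σ hω)
  have key : ∀ v : K, Transcendental k v → fixedSubfield σ = k⟮v⟯ →
      ∃ q : k[X], η = aeval v q • KaehlerDifferential.D k K v := by
    intro v hv hvfix
    obtain ⟨M, rfl, hM⟩ := exists_quadraticModel h2 hord hv hvfix
    obtain ⟨p, q, hpq⟩ := M.exists_coord_eq h2 hreg
    have hηw : η = ((aeval M.x p + aeval M.x q * M.w) / M.w) • KaehlerDifferential.D k K M.x := by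
      apply (M.coord h2).injective
      rw [hpq, map_smul, M.coord_D_x, smul_eq_mul, div_mul_cancel₀ _ M.w_ne_zero]
    have hc := M.conj_x
    have hcw := M.conj_w
    have hcp := M.conj_aeval
    rw [hM] at hc hcw hcp
    have h3 := hφη
    rw [hηw, hφ, kaehlerTransport_smul, kaehlerTransport_D, hc] at h3
    have h4 := congrArg (M.coord h2) h3
    rw [map_smul, map_smul, M.coord_D_x, smul_eq_mul, smul_eq_mul] at h4
    have h5 := mul_right_cancel₀ M.w_ne_zero h4
    rw [map_div₀, map_add, map_mul, hcp, hcp, hcw] at h5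
    have hw := M.w_ne_zero
    rw [div_neg, neg_eq_iff_eq_neg, ← neg_div, div_left_inj' hw] at h5
    have hp : aeval M.x p = 0 := by
      apply mul_left_cancel₀ (two_ne_zero_of_algebra K h2)
      linear_combination h5
    refine ⟨q, ?_⟩
    rw [hηw, hp, zero_add, mul_div_cancel_right₀ _ hw]
  have hu0 : u ≠ 0 := fun h0 => hu (h0 ▸ isAlgebraic_zero)
  obtain ⟨q, hq⟩ := key u hu hfix
  obtain ⟨q', hq'⟩ := key u⁻¹ (fun h => hu (by simpa using h.inv)) (by
    rw [hfix]
    apply le_antisymm <;> rw [IntermediateField.adjoin_simple_le_iff]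
    · have := (k⟮u⁻¹⟯).inv_mem (IntermediateField.mem_adjoin_simple_self k u⁻¹)
      rwa [inv_inv] at this
    · exact (k⟮u⟯).inv_mem (IntermediateField.mem_adjoin_simple_self k u))
  obtain ⟨M, rfl, -⟩ := exists_quadraticModel h2 hord hu hfix
  have h3 := congrArg (M.coord h2) (hq.symm.trans hq')
  rw [Derivation.leibniz_inv, map_smul, map_smul, map_smul, M.coord_D_x] at h3
  simp only [smul_eq_mul] at h3
  have hq0 : q = 0 := by
    by_contra hq0
    have := natDegree_le_of_aeval_eq M.transcendental_x (p := q * X ^ 2) (q := -q') (m := 0) (by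
      rw [map_mul, map_pow, aeval_X, map_neg, pow_zero, one_mul]
      apply mul_right_cancel₀ M.w_ne_zero
      generalize aeval M.x⁻¹ q' = y at h3 ⊢
      field_simp at h3
      linear_combination h3)
    rw [natDegree_mul_X_pow (hp := hq0)] at this
    omega
  rw [hq0, map_zero, zero_smul, hη] at hq
  exact (neg_eq_of_add_eq_zero_right hq).symm

/-! ### Inversion of `x` and the fixed field of `x ↦ -x` -/

theorem exists_expand_eq_of_comp_neg_X {k : Type u} [Field k] (h2 : (2 : k) ≠ 0) {f : k[X]}
    (hf : f.comp (-X) = f) : ∃ g : k[X], f = expand k 2 g := by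
  refine ⟨contract 2 f, ?_⟩
  ext n
  rw [coeff_expand two_pos]
  split_ifs with hn
  · rw [coeff_contract two_ne_zero, Nat.div_mul_cancel hn]
  · have h := congrArg (fun p => coeff p n) hf
    have hodd : Odd n := by rwa [← Nat.not_even_iff_odd, even_iff_two_dvd]
    have hX : (-X : k[X]) = C (-1) * X := by simp
    rw [hX, comp_C_mul_X_coeff, hodd.neg_one_pow] at h
    apply (mul_eq_zero.1 (_ : (2 : k) * f.coeff n = 0)).resolve_left h2
    linear_combination -h

theorem aeval_mem_intermediateField {k K : Type u} [Field k] [Field K] [Algebra k K]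
    (F : IntermediateField k K) {x : K} (hx : x ∈ F) (p : k[X]) : aeval x p ∈ F := by
  have := (aeval (⟨x, hx⟩ : F) p).2
  rwa [← IntermediateField.aeval_coe] at this

namespace QuadraticModel

variable {k K : Type u} [Field k] [Field K] [Algebra k K] (M : QuadraticModel k K)

theorem algHom_ext {L : Type u} [Field L] [Algebra k L] {φ ψ : K →ₐ[k] L} (hx : φ M.x = ψ M.x)
    (hw : φ M.w = ψ M.w) : φ = ψ := by
  ext z
  obtain ⟨p, q, r, hr, h⟩ := M.exists_repr z
  have h1 := congrArg φ h
  have h2 := congrArg ψ h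
  simp only [map_mul, map_add, ← aeval_algHom_apply, hx, hw] at h1 h2
  rw [← h2] at h1
  refine mul_left_cancel₀ ?_ h1
  rw [aeval_algHom_apply]
  exact (_root_.map_ne_zero ψ).2 (M.aeval_ne_zero hr)

theorem conj_conj (z : K) : M.conj (M.conj z) = z := by
  have : M.conj.comp M.conj = AlgHom.id k K :=
    M.algHom_ext (by simp [M.conj_x]) (by simp [M.conj_w])
  exact DFunLike.congr_fun this z

theorem adjoin_eq_top : IntermediateField.adjoin k {M.x, M.w} = ⊤ := by
  rw [eq_top_iff]
  rintro z -
  obtain ⟨p, q, r, hr, h⟩ := M.exists_repr z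
  have hx : M.x ∈ IntermediateField.adjoin k {M.x, M.w} :=
    IntermediateField.subset_adjoin _ _ (by simp)
  have hw : M.w ∈ IntermediateField.adjoin k {M.x, M.w} :=
    IntermediateField.subset_adjoin _ _ (by simp)
  have hp : ∀ p : k[X], aeval M.x p ∈ IntermediateField.adjoin k {M.x, M.w} := fun p =>
    aeval_mem_intermediateField _ hx p
  rw [← mul_div_cancel_left₀ z (M.aeval_ne_zero hr), h]
  exact div_mem (add_mem (hp _) (mul_mem (hp _) hw)) (hp _)

theorem mem_adjoin_of_conj_eq (h2 : (2 : k) ≠ 0) {z : K} (hz : M.conj z = z) : z ∈ k⟮M.x⟯ := by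
  obtain ⟨p, q, r, hr, h⟩ := M.exists_repr z
  obtain ⟨h1, -⟩ := M.eq_and_eq_of_add_eq h2 (a := aeval M.x r * z) (b := 0)
    (a' := aeval M.x p) (b' := aeval M.x q) (by rw [map_mul, M.conj_aeval, hz]) (map_zero _)
    (M.conj_aeval p) (M.conj_aeval q) (by rw [h]; ring)
  have hp : ∀ p : k[X], aeval M.x p ∈ k⟮M.x⟯ := fun p =>
    aeval_mem_intermediateField _ (IntermediateField.mem_adjoin_simple_self k M.x) p
  rw [← mul_div_cancel_left₀ z (M.aeval_ne_zero hr), h1]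
  exact div_mem (hp _) (hp _)

/-- The quadratic model with generators `x⁻¹` and `w / x ^ n`. -/
noncomputable def inv (n : ℕ) (d' : k[X]) (hd' : Squarefree d')
    (h : aeval M.x M.d = aeval M.x⁻¹ d' * M.x ^ (2 * n)) : QuadraticModel k K where
  x := M.x⁻¹
  w := M.w * M.x⁻¹ ^ n
  d := d'
  conj := M.conj
  transcendental_x := fun h => M.transcendental_x (by simpa using h.inv)
  squarefree_d := hd'
  sq_w := by
    have := M.x_ne_zero
    rw [mul_pow, M.sq_w, h, mul_assoc, ← pow_mul, mul_comm n 2, ← mul_pow, mul_inv_cancel₀ this,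
      one_pow, mul_one]
  conj_x := by rw [map_inv₀, M.conj_x]
  conj_w := by rw [map_mul, map_pow, map_inv₀, M.conj_x, M.conj_w]; ring
  exists_repr := fun z => by
    have hx0 := M.x_ne_zero
    obtain ⟨p, q, r, hr, h⟩ := M.exists_repr z
    let N := max p.natDegree (max q.natDegree r.natDegree)
    let := invertibleOfNonzero hx0
    have key : ∀ f : k[X], f.natDegree ≤ N →
        aeval M.x f = aeval M.x⁻¹ (reflect N f) * M.x ^ N := fun f hf => by
      rw [aeval_def, aeval_def, ← invOf_eq_inv,
        eval₂_reflect_mul_pow (algebraMap k K) M.x N f hf]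
    rw [key p (by simp [N]), key q (by simp [N]), key r (by simp [N])] at h
    refine ⟨reflect N p * X ^ n, reflect N q, reflect N r * X ^ n, ?_, ?_⟩
    · exact mul_ne_zero (by simpa using hr) (pow_ne_zero _ X_ne_zero)
    · simp only [map_mul, map_pow, aeval_X]
      apply mul_right_cancel₀ (pow_ne_zero N hx0)
      linear_combination M.x⁻¹ ^ n * h

theorem genus_eq_of_inv [IsAlgClosed k] (h2 : (2 : k) ≠ 0) (m : ℕ) (d' : k[X])
    (hd' : Squarefree d') (h : aeval M.x M.d = aeval M.x⁻¹ d' * M.x ^ (2 * (m + 1))) :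
    genus k K = m := by
  refine M.genus_eq h2 (M.inv (m + 1) d' hd' h) rfl ?_
  change M.w * M.x⁻¹ ^ (m + 1) * M.x ^ (m + 1) = M.w
  rw [mul_assoc, ← mul_pow, inv_mul_cancel₀ M.x_ne_zero, one_pow, mul_one]

/-- If `w ^ 2` is a polynomial in `x ^ 2`, the fixed field of `x ↦ -x`, `w ↦ w` is
`k(x ^ 2, w)`, with the restricted conjugation. -/
noncomputable def fixed (h2 : (2 : k) ≠ 0) (ε : K ≃ₐ[k] K) (hεx : ε M.x = -M.x)
    (hεw : ε M.w = M.w) (d₀ : k[X]) (hd₀ : Squarefree d₀) (h : M.d = expand k 2 d₀) :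
    QuadraticModel k (fixedSubfield ε) where
  x := ⟨M.x ^ 2, by rw [mem_fixedSubfield_iff, map_pow, hεx, neg_sq]⟩
  w := ⟨M.w, by rw [mem_fixedSubfield_iff, hεw]⟩
  d := d₀
  conj := (M.conj.comp (fixedSubfield ε).val).codRestrict (fixedSubfield ε).toSubalgebra (by
    intro z
    have hz := (mem_fixedSubfield_iff ε z).1 z.2
    refine (mem_fixedSubfield_iff ε _).2 ?_
    have hcomm : (ε : K →ₐ[k] K).comp M.conj = M.conj.comp ε :=
      M.algHom_ext (by simp [M.conj_x, hεx]) (by simp [M.conj_w, hεw])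
    have h3 := DFunLike.congr_fun hcomm (z : K)
    change ε (M.conj z) = M.conj (ε z) at h3
    rw [hz] at h3
    exact h3)
  transcendental_x := by
    intro halg
    have := halg.algebraMap (A := K)
    exact M.transcendental_x (IsAlgebraic.of_pow two_pos this)
  squarefree_d := hd₀
  sq_w := by
    apply Subtype.ext
    rw [← IntermediateField.aeval_coe]
    change M.w ^ 2 = aeval (M.x ^ 2) d₀
    rw [M.sq_w, h, expand_aeval]
  conj_x := Subtype.ext (by
    change M.conj (M.x ^ 2) = M.x ^ 2
    rw [map_pow, M.conj_x])
  conj_w := Subtype.ext M.conj_w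
  exists_repr := fun z => by
    have hz := (mem_fixedSubfield_iff ε z).1 z.2
    obtain ⟨p, q, r, hr, hrep⟩ := M.exists_repr z
    have hcomp : ∀ f : k[X], ε (aeval M.x f) = aeval M.x (f.comp (-X)) := fun f => by
      have := aeval_algHom_apply (ε : K →ₐ[k] K) M.x f
      rw [aeval_comp]
      simpa [hεx] using this.symm
    -- multiplication by `r(-x)` and averaging over `x ↦ -x` makes all three coefficients even
    have hrep' := congrArg ε hrep
    rw [map_mul, map_add, map_mul, hz, hεw, hcomp, hcomp, hcomp] at hrep'
    have hcc : ∀ f : k[X], (f.comp (-X)).comp (-X) = f := fun f => by simp [comp_assoc]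
    obtain ⟨p₀, hp₀⟩ := exists_expand_eq_of_comp_neg_X h2
      (f := p * r.comp (-X) + p.comp (-X) * r) (by rw [add_comp, mul_comp, mul_comp, hcc, hcc]; ring)
    obtain ⟨q₀, hq₀⟩ := exists_expand_eq_of_comp_neg_X h2
      (f := q * r.comp (-X) + q.comp (-X) * r) (by rw [add_comp, mul_comp, mul_comp, hcc, hcc]; ring)
    obtain ⟨r₀, hr₀⟩ := exists_expand_eq_of_comp_neg_X h2
      (f := C 2 * (r * r.comp (-X))) (by rw [mul_comp, mul_comp, hcc, C_comp]; ring)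
    refine ⟨p₀, q₀, r₀, ?_, ?_⟩
    · rintro rfl
      have hr' : r.comp (-X) ≠ 0 := fun h0 => hr (by rw [← hcc r, h0, zero_comp])
      rw [map_zero] at hr₀
      exact mul_ne_zero (C_ne_zero.2 h2) (mul_ne_zero hr hr') hr₀
    · apply Subtype.ext
      simp only [IntermediateField.coe_mul, IntermediateField.coe_add,
        ← IntermediateField.aeval_coe]
      rw [← expand_aeval, ← expand_aeval, ← expand_aeval, ← hp₀, ← hq₀, ← hr₀]
      simp only [map_mul, map_add, map_ofNat]
      linear_combination aeval M.x (r.comp (-X)) * hrep + aeval M.x r * hrep'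

end QuadraticModel

/-! ### The discriminant and the field `K_{a,b,c}` -/

section Discriminant

variable {k : Type u} [Field k]

theorem two_ne_zero_of_Δ {a b c : k} (h : Δ a b c ≠ 0) : (2 : k) ≠ 0 := by
  intro h2
  apply h
  have : (256 : k) = 2 * 128 := by norm_num
  unfold Δ
  rw [this, h2]
  ring

theorem Δ_reverse (a b c : k) : Δ c b a = Δ a b c := by
  unfold Δ
  ring

/-- The quartic `X ^ 4 + a X ^ 3 + b X ^ 2 + c X + 1`, whose value at `X ^ 2` is the octic. -/
noncomputable def quartic (a b c : k) : k[X] :=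
  X ^ 4 + C a * X ^ 3 + C b * X ^ 2 + C c * X + 1

theorem expand_quartic (a b c : k) : octic a b c = expand k 2 (quartic a b c) := by
  simp only [octic, quartic, map_add, map_mul, map_pow, expand_X, expand_C, map_one]
  ring

/-- `Δ` vanishes when the quartic has a double root `s`: the coefficients `b` and `c` are then
determined by `a` and `s`. -/
theorem Δ_eq_zero_of_double_root {a b c s : k} (h : s ^ 4 + a * s ^ 3 + b * s ^ 2 + c * s + 1 = 0)
    (h' : 4 * s ^ 3 + 3 * a * s ^ 2 + 2 * b * s + c = 0) : Δ a b c = 0 := by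
  have hs : s ≠ 0 := by rintro rfl; simp at h
  have hb : b = (1 - 3 * s ^ 4 - 2 * a * s ^ 3) / s ^ 2 := by
    rw [eq_div_iff (pow_ne_zero 2 hs)]
    linear_combination -h + s * h'
  have hc : c = (2 * s ^ 4 + a * s ^ 3 - 2) / s := by
    rw [eq_div_iff hs]
    linear_combination 2 * h - s * h'
  rw [hb, hc, Δ]
  field_simp
  ring

theorem squarefree_quartic [IsAlgClosed k] {a b c : k} (h : Δ a b c ≠ 0) :
    Squarefree (quartic a b c) := by
  refine Separable.squarefree ((isCoprime_iff_aeval_ne_zero_of_isAlgClosed k k _ _).2 fun s => ?_)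
  by_contra! hs
  apply h
  apply Δ_eq_zero_of_double_root (s := s)
  · simpa [quartic] using hs.1
  · have h1 := hs.2
    simp [quartic] at h1
    linear_combination h1

theorem squarefree_octic [IsAlgClosed k] {a b c : k} (h : Δ a b c ≠ 0) :
    Squarefree (octic a b c) := by
  refine Separable.squarefree ((isCoprime_iff_aeval_ne_zero_of_isAlgClosed k k _ _).2 fun t => ?_)
  by_contra! ht
  obtain ⟨h1, h3⟩ := ht
  apply h
  have ht0 : t ≠ 0 := by rintro rfl; simp [octic] at h1
  apply Δ_eq_zero_of_double_root (s := t ^ 2)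
  · simp [octic] at h1
    linear_combination h1
  · simp [octic] at h3
    apply (mul_eq_zero.1 (_ : (2 * t) * _ = 0)).resolve_left (mul_ne_zero (two_ne_zero_of_Δ h) ht0)
    linear_combination h3

theorem aeval_octic {K : Type u} [Field K] [Algebra k K] (a b c : k) (x : K) :
    aeval x (octic a b c) = x ^ 8 + algebraMap k K a * x ^ 6 + algebraMap k K b * x ^ 4
      + algebraMap k K c * x ^ 2 + 1 := by
  simp [octic]

theorem aeval_octic_inv {K : Type u} [Field K] [Algebra k K] (a b c : k) {x : K} (hx : x ≠ 0) :
    aeval x (octic a b c) = aeval x⁻¹ (octic c b a) * x ^ 8 := by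
  rw [aeval_octic, aeval_octic]
  field_simp
  ring

theorem aeval_quartic_inv {K : Type u} [Field K] [Algebra k K] (a b c : k) {x : K} (hx : x ≠ 0) :
    aeval x (quartic a b c) = aeval x⁻¹ (quartic c b a) * x ^ 4 := by
  simp only [quartic, map_add, map_mul, map_pow, aeval_X, aeval_C, map_one]
  field_simp
  ring

end Discriminant

section CurveField

variable {k : Type u} [Field k] {a b c : k} (h : Δ a b c ≠ 0)

theorem aeval_genX (p : k[X]) : aeval (genX a b c h) p =
    (AdjoinRoot.of (definingPoly a b c) (algebraMap k[X] (RatFunc k) p) : CurveField a b c h) := by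
  let f : RatFunc k →ₐ[k] CurveField a b c h :=
    (AdjoinRoot.ofAlgHom k (definingPoly a b c) : RatFunc k →ₐ[k] AdjoinRoot (definingPoly a b c))
  change aeval (f RatFunc.X) p = f (algebraMap k[X] (RatFunc k) p)
  rw [aeval_algHom_apply, ← RatFunc.algebraMap_X, aeval_algebraMap_apply, aeval_X_left_apply]

theorem transcendental_genX : Transcendental k (genX a b c h) := by
  rw [transcendental_iff_injective]
  intro p q hpq
  rw [aeval_genX, aeval_genX] at hpq
  have : Fact (Irreducible (definingPoly a b c)) := ⟨definingPoly_irreducible a b c h⟩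
  exact RatFunc.algebraMap_injective k ((AdjoinRoot.of (definingPoly a b c)).injective hpq)

theorem sq_genY : genY a b c h ^ 2 = aeval (genX a b c h) (octic a b c) := by
  rw [aeval_genX]
  have h1 : AdjoinRoot.mk (definingPoly a b c) (definingPoly a b c) = 0 := AdjoinRoot.mk_self
  conv at h1 => enter [1, 2]; rw [definingPoly]
  rw [map_sub, map_pow, AdjoinRoot.mk_X, AdjoinRoot.mk_C, sub_eq_zero] at h1
  exact h1

theorem exists_repr_genX_genY (z : CurveField a b c h) : ∃ p q r : k[X], r ≠ 0 ∧
    aeval (genX a b c h) r * z =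
      aeval (genX a b c h) p + aeval (genX a b c h) q * genY a b c h := by
  obtain ⟨g, rfl⟩ : ∃ g, (AdjoinRoot.mk (definingPoly a b c) g : CurveField a b c h) = z :=
    AdjoinRoot.mk_surjective z
  have hmonic : (definingPoly a b c).Monic := monic_X_pow_sub_C _ two_ne_zero
  have hdeg : (definingPoly a b c).natDegree = 2 := natDegree_X_pow_sub_C
  have hne : definingPoly a b c ≠ 1 := by
    intro h1
    rw [h1, natDegree_one] at hdeg
    omega
  obtain ⟨s, t, hst⟩ := exists_eq_X_add_C_of_natDegree_le_one
    (p := g %ₘ definingPoly a b c) (by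
      have := natDegree_modByMonic_lt g hmonic hne
      omega)
  have hg : AdjoinRoot.mk (definingPoly a b c) g =
      AdjoinRoot.of _ s * AdjoinRoot.root _ + AdjoinRoot.of _ t := by
    conv_lhs => rw [← modByMonic_add_div g (definingPoly a b c), hst]
    simp [AdjoinRoot.mk_self]
  obtain ⟨s₁, s₂, hs₂, rfl⟩ := IsFractionRing.div_surjective (A := k[X]) s
  obtain ⟨t₁, t₂, ht₂, rfl⟩ := IsFractionRing.div_surjective (A := k[X]) t
  have hs₂' := nonZeroDivisors.ne_zero hs₂
  have ht₂' := nonZeroDivisors.ne_zero ht₂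
  have hne' : ∀ p : k[X], p ≠ 0 → aeval (genX a b c h) p ≠ 0 := fun p hp h0 => hp
    (transcendental_iff_injective.1 (transcendental_genX h) (by simpa using h0))
  have hdiv : ∀ p q : k[X], (AdjoinRoot.of (definingPoly a b c)
      (algebraMap k[X] (RatFunc k) p / algebraMap k[X] (RatFunc k) q) : CurveField a b c h) =
      aeval (genX a b c h) p / aeval (genX a b c h) q := fun p q => by
    rw [aeval_genX, aeval_genX]
    have : Fact (Irreducible (definingPoly a b c)) := ⟨definingPoly_irreducible a b c h⟩
    exact map_div₀ (AdjoinRoot.of (definingPoly a b c)) _ _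
  have hg' : (AdjoinRoot.mk (definingPoly a b c) g : CurveField a b c h) =
      aeval (genX a b c h) s₁ / aeval (genX a b c h) s₂ * genY a b c h +
        aeval (genX a b c h) t₁ / aeval (genX a b c h) t₂ := by
    rw [← hdiv, ← hdiv]
    exact hg
  refine ⟨t₁ * s₂, s₁ * t₂, s₂ * t₂, mul_ne_zero hs₂' ht₂', ?_⟩
  have h3 := hne' _ hs₂'
  have h4 := hne' _ ht₂'
  rw [hg']
  simp only [map_mul]
  field_simp
  ring

/-- The universal property of `K_{a,b,c}`: it embeds into any field with a solution of its equation
whose first coordinate is transcendental over `k`. -/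
theorem exists_curveField_algHom {L : Type u} [Field L] [Algebra k L] {V W : L}
    (hV : Transcendental k V) (hW : W ^ 2 = aeval V (octic a b c)) :
    ∃ φ : CurveField a b c h →ₐ[k] L, φ (genX a b c h) = V ∧ φ (genY a b c h) = W := by
  have hinj : Function.Injective (aeval V : k[X] →ₐ[k] L) := transcendental_iff_injective.1 hV
  let i : RatFunc k →ₐ[k] L := IsFractionRing.liftAlgHom (g := (aeval V : k[X] →ₐ[k] L)) hinj
  have hi : ∀ p : k[X], i (algebraMap k[X] (RatFunc k) p) = aeval V p := fun p =>
    IsFractionRing.lift_algebraMap hinj p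
  let φ : AdjoinRoot (definingPoly a b c) →ₐ[k] L :=
    AdjoinRoot.liftAlgHom (definingPoly a b c) i W (by
      rw [definingPoly, eval₂_sub, eval₂_pow, eval₂_X, eval₂_C, hW]
      exact sub_eq_zero.2 (hi _).symm)
  refine ⟨φ, ?_, ?_⟩
  · change φ (AdjoinRoot.of _ RatFunc.X) = V
    exact (AdjoinRoot.liftAlgHom_of (definingPoly a b c) i W _ RatFunc.X).trans
      (by rw [← RatFunc.algebraMap_X, hi, aeval_X])
  · exact AdjoinRoot.liftAlgHom_root (definingPoly a b c) i W _

theorem exists_curveField_conj : ∃ φ : CurveField a b c h →ₐ[k] CurveField a b c h,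
    φ (genX a b c h) = genX a b c h ∧ φ (genY a b c h) = -genY a b c h :=
  exists_curveField_algHom h (transcendental_genX h) (by rw [neg_sq, sq_genY])

/-- `K_{a,b,c}` as a quadratic extension of `k(X)`. -/
noncomputable def curveModel [IsAlgClosed k] : QuadraticModel k (CurveField a b c h) where
  x := genX a b c h
  w := genY a b c h
  d := octic a b c
  conj := (exists_curveField_conj h).choose
  transcendental_x := transcendental_genX h
  squarefree_d := squarefree_octic h
  sq_w := sq_genY h
  conj_x := (exists_curveField_conj h).choose_spec.1
  conj_w := (exists_curveField_conj h).choose_spec.2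
  exists_repr := exists_repr_genX_genY h

end CurveField

/-! ### The automorphisms of `K_{a,b,c}` -/

section Automorphisms

theorem QuadraticModel.finrank_adjoin_x {k K : Type u} [Field k] [Field K] [Algebra k K]
    (M : QuadraticModel k K) (h2 : (2 : k) ≠ 0) : Module.finrank k⟮M.x⟯ K = 2 := by
  have hconj : ∀ y : k⟮M.x⟯, M.conj y = y := fun y => by
    obtain ⟨p, r, hr, hy⟩ := exists_div_of_mem_adjoin_simple y.2
    have := congrArg M.conj hy
    rw [map_mul, M.conj_aeval, M.conj_aeval, ← hy] at this
    exact mul_left_cancel₀ hr this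
  have hp : ∀ p : k[X], aeval M.x p ∈ k⟮M.x⟯ := fun p =>
    aeval_mem_intermediateField _ (IntermediateField.mem_adjoin_simple_self k M.x) p
  have hli : LinearIndependent k⟮M.x⟯ ![(1 : K), M.w] := by
    rw [LinearIndependent.pair_iff]
    intro s t hst
    rw [Algebra.smul_def, Algebra.smul_def, mul_one] at hst
    obtain ⟨hs, ht⟩ := M.eq_and_eq_of_add_eq h2 (a := s) (b := t) (a' := 0) (b' := 0) (hconj s)
      (hconj t) (map_zero _) (map_zero _) (by rw [zero_mul, add_zero]; exact hst)
    exact ⟨Subtype.ext hs, Subtype.ext ht⟩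
  have hspan : ⊤ ≤ Submodule.span k⟮M.x⟯ (Set.range ![(1 : K), M.w]) := by
    rintro z -
    obtain ⟨p, q, r, hr, hrep⟩ := M.exists_repr z
    have hr' := M.aeval_ne_zero hr
    rw [Matrix.range_cons, Matrix.range_cons, Matrix.range_empty, Set.union_empty,
      Set.singleton_union, Submodule.mem_span_pair]
    refine ⟨⟨_, div_mem (hp p) (hp r)⟩, ⟨_, div_mem (hp q) (hp r)⟩, ?_⟩
    rw [Algebra.smul_def, Algebra.smul_def]
    change aeval M.x p / aeval M.x r * 1 + aeval M.x q / aeval M.x r * M.w = z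
    field_simp
    linear_combination -hrep
  rw [Module.finrank_eq_card_basis (Module.Basis.mk hli hspan), Fintype.card_fin]

variable {k : Type u} [Field k] [IsAlgClosed k] {a b c : k} (h : Δ a b c ≠ 0)

theorem curve_mem_regularDifferentials_iff (ω : Ω[CurveField a b c h⁄k]) :
    ω ∈ regularDifferentials k (CurveField a b c h) ↔
      ∃ p ∈ degreeLT k 3, (curveModel h).coord (two_ne_zero_of_Δ h) ω = aeval (genX a b c h) p := by
  have hx0 := (curveModel h).x_ne_zero
  have h' : Δ c b a ≠ 0 := by rwa [Δ_reverse]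
  refine (curveModel h).mem_regularDifferentials_iff (two_ne_zero_of_Δ h)
    ((curveModel h).inv 4 (octic c b a) (squarefree_octic h') (aeval_octic_inv a b c hx0)) rfl ?_ ω
  change (curveModel h).w * (curveModel h).x⁻¹ ^ 4 * (curveModel h).x ^ (3 + 1) = _
  rw [mul_assoc, ← mul_pow, inv_mul_cancel₀ hx0, one_pow, mul_one]

theorem genus_curveField : genus k (CurveField a b c h) = 3 :=
  (curveModel h).genus_eq_of_inv (two_ne_zero_of_Δ h) 3 (octic c b a)
    (squarefree_octic (by rwa [Δ_reverse])) (aeval_octic_inv a b c (curveModel h).x_ne_zero)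

theorem genus_fixedSubfield_negXAut : genus k (fixedSubfield (negXAut a b c h)) = 1 := by
  have := ((curveModel h).fixed (two_ne_zero_of_Δ h) (negXAut a b c h) (negXAut_genX a b c h)
    (negXAut_genY a b c h) (quartic a b c) (squarefree_quartic h)
    (expand_quartic a b c)).genus_eq_of_inv (two_ne_zero_of_Δ h) 1 (quartic c b a)
    (squarefree_quartic (by rwa [Δ_reverse])) (aeval_quartic_inv a b c (QuadraticModel.x_ne_zero _))
  simpa using this

/-- A hyperelliptic involution acts as `-1` on `dX / Y` and on `X dX / Y`, hence fixes their
quotient `X`. -/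
theorem hyperellipticInvolution_genX {σ : CurveField a b c h ≃ₐ[k] CurveField a b c h}
    (hσ : IsHyperellipticInvolution σ) : σ (genX a b c h) = genX a b c h := by
  have h2 := two_ne_zero_of_Δ h
  set M := curveModel h
  set ω := (M.coord h2).symm 1
  have hω : ω ∈ regularDifferentials k (CurveField a b c h) := by
    rw [curve_mem_regularDifferentials_iff]
    exact ⟨1, by rw [mem_degreeLT, degree_one]; norm_num,
      by rw [LinearEquiv.apply_symm_apply, map_one]⟩
  have hXω : genX a b c h • ω ∈ regularDifferentials k (CurveField a b c h) := by
    rw [curve_mem_regularDifferentials_iff]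
    exact ⟨X, by rw [mem_degreeLT, degree_X]; norm_num,
      by rw [map_smul, LinearEquiv.apply_symm_apply, aeval_X, smul_eq_mul, mul_one]⟩
  have h1 := kaehlerTransport_eq_neg h2 hσ hω
  have h3 := kaehlerTransport_eq_neg h2 hσ hXω
  rw [kaehlerTransport_smul, h1] at h3
  have h4 := congrArg (M.coord h2) h3
  simpa [ω] using h4

theorem eq_one_of_fixes {σ : CurveField a b c h ≃ₐ[k] CurveField a b c h}
    (hX : σ (genX a b c h) = genX a b c h) (hY : σ (genY a b c h) = genY a b c h) : σ = 1 := by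
  have : (σ : CurveField a b c h →ₐ[k] CurveField a b c h) = AlgHom.id k _ :=
    (curveModel h).algHom_ext hX hY
  ext z
  exact DFunLike.congr_fun this z

/-- The hyperelliptic involution `X ↦ X`, `Y ↦ -Y`. -/
noncomputable def curveConj : CurveField a b c h ≃ₐ[k] CurveField a b c h :=
  AlgEquiv.ofAlgHom (curveModel h).conj (curveModel h).conj
    (AlgHom.ext (curveModel h).conj_conj) (AlgHom.ext (curveModel h).conj_conj)

theorem curveConj_genX : curveConj h (genX a b c h) = genX a b c h := (curveModel h).conj_x

theorem curveConj_genY : curveConj h (genY a b c h) = -genY a b c h := (curveModel h).conj_w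

theorem isHyperellipticInvolution_curveConj : IsHyperellipticInvolution (curveConj h) := by
  have h2 := two_ne_zero_of_Δ h
  refine ⟨orderOf_eq_prime (AlgEquiv.ext (curveModel h).conj_conj) fun h1 => ?_, genX a b c h,
    transcendental_genX h, le_antisymm (fun z hz => ?_) ?_⟩
  · have h3 := curveConj_genY h
    rw [h1, AlgEquiv.one_apply, eq_neg_iff_add_eq_zero, ← two_mul, mul_eq_zero] at h3
    exact h3.elim (two_ne_zero_of_algebra _ h2) (curveModel h).w_ne_zero
  · exact (curveModel h).mem_adjoin_of_conj_eq h2 ((mem_fixedSubfield_iff _ z).1 hz)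
  · rw [IntermediateField.adjoin_simple_le_iff, mem_fixedSubfield_iff]
    exact curveConj_genX h

theorem eq_one_or_eq_curveConj {σ : CurveField a b c h ≃ₐ[k] CurveField a b c h}
    (hX : σ (genX a b c h) = genX a b c h) : σ = 1 ∨ σ = curveConj h := by
  have hY : σ (genY a b c h) ^ 2 = genY a b c h ^ 2 := by
    have := aeval_algHom_apply (σ : CurveField a b c h →ₐ[k] CurveField a b c h) (genX a b c h)
      (octic a b c)
    rw [← map_pow, sq_genY]
    simpa [hX] using this.symm
  rcases sq_eq_sq_iff_eq_or_eq_neg.1 hY with hY | hY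
  · exact Or.inl (eq_one_of_fixes h hX hY)
  · right
    have : (σ : CurveField a b c h →ₐ[k] CurveField a b c h) = curveConj h :=
      (curveModel h).algHom_ext (hX.trans (curveConj_genX h).symm)
        (hY.trans (curveConj_genY h).symm)
    ext z
    exact DFunLike.congr_fun this z

/-- The hyperelliptic involution is unique. -/
theorem isHyperellipticInvolution_iff {σ : CurveField a b c h ≃ₐ[k] CurveField a b c h} :
    IsHyperellipticInvolution σ ↔ σ = curveConj h := by
  refine ⟨fun hσ => ?_, fun hσ => hσ ▸ isHyperellipticInvolution_curveConj h⟩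
  refine (eq_one_or_eq_curveConj h (hyperellipticInvolution_genX h hσ)).resolve_left ?_
  rintro rfl
  have := hσ.1
  rw [orderOf_one] at this
  omega

theorem mem_hyperellipticSubgroup_iff {σ : CurveField a b c h ≃ₐ[k] CurveField a b c h} :
    σ ∈ hyperellipticSubgroup k (CurveField a b c h) ↔ σ (genX a b c h) = genX a b c h := by
  constructor
  · intro hσ
    have hle : hyperellipticSubgroup k (CurveField a b c h) ≤
        MulAction.stabilizer (CurveField a b c h ≃ₐ[k] CurveField a b c h) (genX a b c h) := by
      unfold hyperellipticSubgroup Subgroup.normalClosure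
      rw [Subgroup.closure_le]
      intro τ hτ
      obtain ⟨ρ, hρ, hconj⟩ := Group.mem_conjugatesOfSet_iff.1 hτ
      obtain ⟨g, rfl⟩ := isConj_iff.1 hconj
      exact hyperellipticInvolution_genX h (isHyperellipticInvolution_autCongr g hρ)
    exact hle hσ
  · intro hσ
    rcases eq_one_or_eq_curveConj h hσ with rfl | rfl
    · exact one_mem _
    · exact Subgroup.subset_normalClosure (isHyperellipticInvolution_curveConj h)

theorem toReduced_eq_epsilon_iff (σ : CurveField a b c h ≃ₐ[k] CurveField a b c h) :
    toReduced σ = epsilon a b c h ↔ σ (genX a b c h) = -genX a b c h := by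
  unfold toReduced epsilon toReduced
  rw [eq_comm, QuotientGroup.eq, mem_hyperellipticSubgroup_iff, AlgEquiv.mul_apply,
    AlgEquiv.aut_inv, AlgEquiv.symm_apply_eq, negXAut_genX]

theorem negXAut_sq : negXAut a b c h ^ 2 = 1 := by
  apply eq_one_of_fixes h <;> simp [pow_two, negXAut_genX, negXAut_genY]

theorem genX_ne_neg : genX a b c h ≠ -genX a b c h := by
  intro h3
  rw [eq_neg_iff_add_eq_zero, ← two_mul, mul_eq_zero] at h3
  exact h3.elim (two_ne_zero_of_algebra _ (two_ne_zero_of_Δ h)) (curveModel h).x_ne_zero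

theorem isReducedEllipticInvolution_epsilon :
    IsReducedEllipticInvolution (epsilon a b c h) := by
  refine ⟨orderOf_eq_prime ?_ fun h1 => ?_, negXAut a b c h, ⟨orderOf_eq_prime (negXAut_sq h) ?_,
    genus_fixedSubfield_negXAut h⟩, rfl⟩
  · unfold epsilon toReduced
    rw [← QuotientGroup.mk_pow, negXAut_sq, QuotientGroup.mk_one]
  · have h3 := (toReduced_eq_epsilon_iff h 1).1 (by rw [h1]; rfl)
    exact genX_ne_neg h h3
  · intro h1
    have h3 := negXAut_genX a b c h
    rw [h1] at h3
    exact genX_ne_neg h h3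

theorem isHyperellipticField_curveField : IsHyperellipticField k (CurveField a b c h) := by
  have hfin : Module.finrank k⟮genX a b c h⟯ (CurveField a b c h) = 2 :=
    (curveModel h).finrank_adjoin_x (two_ne_zero_of_Δ h)
  refine ⟨⟨genX a b c h, transcendental_genX h, FiniteDimensional.of_finrank_pos (by omega)⟩, ?_,
    k⟮genX a b c h⟯, ⟨genX a b c h, transcendental_genX h, rfl⟩, hfin⟩
  rw [genus_curveField]
  norm_num

end Automorphisms

/-! ### Isomorphisms of pairs -/

section Invariants

variable {k : Type u} [Field k] {a b c a' b' c' : k}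

/-- The octic of `(a, b, c)` is obtained from that of `(a', b', c')` by the substitution `X ↦ l X`,
or `X ↦ l X⁻¹` followed by multiplication by `X ^ 8`, where `l ^ 2 = m`. -/
def Related (a b c a' b' c' m : k) : Prop :=
  m ^ 4 = 1 ∧ b' * m ^ 2 = b ∧
    (a' * m ^ 3 = a ∧ c' * m = c ∨ c' * m = a ∧ a' * m ^ 3 = c)

theorem Related.invariants_eq {m : k} (hm : Related a b c a' b' c' m) :
    s2 a b c = s2 a' b' c' ∧ s3 a b c = s3 a' b' c' ∧ s4 a b c = s4 a' b' c' := by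
  obtain ⟨h4, rfl, ⟨rfl, rfl⟩ | ⟨rfl, rfl⟩⟩ := hm
  · refine ⟨?_, ?_, ?_⟩ <;> simp only [s2, s3, s4]
    · linear_combination a' * c' * h4
    · linear_combination (a' ^ 2 * b' * (m ^ 4 + 1) + c' ^ 2 * b') * h4
    · linear_combination (a' ^ 4 * (m ^ 8 + m ^ 4 + 1) + c' ^ 4) * h4
  · refine ⟨?_, ?_, ?_⟩ <;> simp only [s2, s3, s4]
    · linear_combination a' * c' * h4
    · linear_combination (a' ^ 2 * b' * (m ^ 4 + 1) + c' ^ 2 * b') * h4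
    · linear_combination (a' ^ 4 * (m ^ 8 + m ^ 4 + 1) + c' ^ 4) * h4

/-- The sum of squares and the product determine an unordered pair up to a common sign. -/
theorem exists_sign_of_sq_add_sq_eq {A B : k} (h2 : (2 : k) ≠ 0)
    (hs : A ^ 2 + B ^ 2 = a ^ 2 + c ^ 2) (hp : A * B = a * c) :
    ∃ e : k, e ^ 2 = 1 ∧ (A = e * a ∧ B = e * c ∨ B = e * a ∧ A = e * c) := by
  have h1 : (A + B) ^ 2 = (a + c) ^ 2 := by linear_combination hs + 2 * hp
  have h3 : (A - B) ^ 2 = (a - c) ^ 2 := by linear_combination hs - 2 * hp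
  rcases sq_eq_sq_iff_eq_or_eq_neg.1 h1 with h1 | h1 <;>
    rcases sq_eq_sq_iff_eq_or_eq_neg.1 h3 with h3 | h3
  · exact ⟨1, by ring, Or.inl ⟨mul_left_cancel₀ h2 (by linear_combination h1 + h3),
      mul_left_cancel₀ h2 (by linear_combination h1 - h3)⟩⟩
  · exact ⟨1, by ring, Or.inr ⟨mul_left_cancel₀ h2 (by linear_combination h1 - h3),
      mul_left_cancel₀ h2 (by linear_combination h1 + h3)⟩⟩
  · exact ⟨-1, by ring, Or.inr ⟨mul_left_cancel₀ h2 (by linear_combination h1 - h3),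
      mul_left_cancel₀ h2 (by linear_combination h1 + h3)⟩⟩
  · exact ⟨-1, by ring, Or.inl ⟨mul_left_cancel₀ h2 (by linear_combination h1 + h3),
      mul_left_cancel₀ h2 (by linear_combination h1 - h3)⟩⟩

/-- Since `𝔰₄ + 2 𝔰₂² = (a² + c²)²`, equality of the invariants gives `a'² + c'² = ±(a² + c²)` and
`b' = ±b` with the same sign. For the sign `-1` the triple is twisted by a square root of `-1`. -/
theorem exists_related_of_invariants_eq [IsAlgClosed k] (h2 : (2 : k) ≠ 0)
    (hne : s4 a b c + 2 * s2 a b c ^ 2 ≠ 0) (e2 : s2 a b c = s2 a' b' c')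
    (e3 : s3 a b c = s3 a' b' c') (e4 : s4 a b c = s4 a' b' c') :
    ∃ m, Related a b c a' b' c' m := by
  simp only [s2, s3, s4] at hne e2 e3 e4
  have hs : a ^ 2 + c ^ 2 ≠ 0 := fun h0 => hne (by linear_combination (a ^ 2 + c ^ 2) * h0)
  have hsq : (a' ^ 2 + c' ^ 2) ^ 2 = (a ^ 2 + c ^ 2) ^ 2 := by
    linear_combination -e4 - 2 * (a * c + a' * c') * e2
  rcases sq_eq_sq_iff_eq_or_eq_neg.1 hsq with h1 | h1
  · have hb : b' = b := mul_left_cancel₀ hs (by linear_combination -e3 - b' * h1)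
    obtain ⟨e, he, h3⟩ := exists_sign_of_sq_add_sq_eq h2 h1 e2.symm
    refine ⟨e, by linear_combination (e ^ 2 + 1) * he, by linear_combination hb + b' * he, ?_⟩
    rcases h3 with ⟨rfl, rfl⟩ | ⟨rfl, rfl⟩
    · exact Or.inl ⟨by linear_combination a * (e ^ 2 + 1) * he, by linear_combination c * he⟩
    · exact Or.inr ⟨by linear_combination a * he, by linear_combination c * (e ^ 2 + 1) * he⟩
  · obtain ⟨i, hi⟩ := IsAlgClosed.exists_pow_nat_eq (-1 : k) two_pos
    have hb : b' = -b := mul_left_cancel₀ hs (by linear_combination e3 + b' * h1)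
    obtain ⟨e, he, h3⟩ := exists_sign_of_sq_add_sq_eq (A := -i * a') (B := i * c') (a := a) (c := c)
      h2 (by linear_combination (a' ^ 2 + c' ^ 2) * hi - h1)
      (by linear_combination -a' * c' * hi - e2)
    refine ⟨i * e, ?_, ?_, ?_⟩
    · linear_combination (e ^ 4 * (i ^ 2 - 1)) * hi + (e ^ 2 + 1) * he
    · linear_combination b' * e ^ 2 * hi - b' * he - hb
    · rcases h3 with ⟨hA, hB⟩ | ⟨hB, hA⟩
      · exact Or.inl ⟨by linear_combination a' * i * e ^ 3 * hi + e ^ 3 * hA + a * (e ^ 2 + 1) * he,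
          by linear_combination e * hB + c * he⟩
      · exact Or.inr ⟨by linear_combination e * hB + a * he,
          by linear_combination a' * i * e ^ 3 * hi + e ^ 3 * hA + c * (e ^ 2 + 1) * he⟩

end Invariants

section Isomorphism

variable {k : Type u} [Field k] [IsAlgClosed k] {a b c a' b' c' : k} (h : Δ a b c ≠ 0)
  (h' : Δ a' b' c' ≠ 0)

/-- An isomorphism maps `dX' / Y'`, `X' dX' / Y'` and `X' ^ 2 dX' / Y'` to `Q(X) dX / Y`,
`P(X) dX / Y` and `R(X) dX / Y` with `P, Q, R` of degree at most `2` and `P ^ 2 = Q R`. Hence the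
image `P / Q` of `X'` is a quotient of polynomials of degree at most `1`. -/
theorem exists_linear_fraction (β : CurveField a' b' c' h' ≃ₐ[k] CurveField a b c h) :
    ∃ p q : k[X], p.natDegree ≤ 1 ∧ q.natDegree ≤ 1 ∧ q ≠ 0 ∧
      aeval (genX a b c h) q * β (genX a' b' c' h') = aeval (genX a b c h) p := by
  have h2 := two_ne_zero_of_Δ h
  set M := curveModel h
  set M' := curveModel h'
  have hM : M.x = genX a b c h := rfl
  set ω := (M'.coord h2).symm 1
  set φ := kaehlerTransport (β : CurveField a' b' c' h' →ₐ[k] CurveField a b c h) with hφ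
  set V := β (genX a' b' c' h')
  have hreg : ∀ i < 3, ∃ p ∈ degreeLT k 3, V ^ i * M.coord h2 (φ ω) = aeval (genX a b c h) p := by
    intro i hi
    have hω : genX a' b' c' h' ^ i • ω ∈ regularDifferentials k (CurveField a' b' c' h') := by
      rw [curve_mem_regularDifferentials_iff]
      refine ⟨X ^ i, by rw [mem_degreeLT, degree_X_pow]; exact_mod_cast hi, ?_⟩
      rw [map_smul, LinearEquiv.apply_symm_apply, map_pow, aeval_X, smul_eq_mul, mul_one]
    have h3 := kaehlerTransport_mem_regularDifferentials β hω
    rw [curve_mem_regularDifferentials_iff, kaehlerTransport_smul, map_smul, smul_eq_mul] at h3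
    simpa using h3
  obtain ⟨Q, hQ, hQe⟩ := hreg 0 (by norm_num)
  obtain ⟨P, hP, hPe⟩ := hreg 1 (by norm_num)
  obtain ⟨R, hR, hRe⟩ := hreg 2 (by norm_num)
  rw [pow_zero, one_mul] at hQe
  rw [hQe] at hPe hRe
  have hdeg : ∀ p ∈ degreeLT k 3, p.natDegree ≤ 2 := fun p hp => by
    by_cases hp0 : p = 0
    · simp [hp0]
    · rw [mem_degreeLT, degree_eq_natDegree hp0] at hp
      have : p.natDegree < 3 := by exact_mod_cast hp
      omega
  have hQ0 : Q ≠ 0 := by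
    rintro rfl
    rw [map_zero, LinearEquiv.map_eq_zero_iff] at hQe
    have h3 := kaehlerTransport_comp_eq_self
      (β : CurveField a' b' c' h' →ₐ[k] CurveField a b c h)
      (β.symm : CurveField a b c h →ₐ[k] CurveField a' b' c' h') (fun z => β.symm_apply_apply z) ω
    rw [← hφ, hQe, map_zero] at h3
    have h4 := congrArg (M'.coord h2) h3
    simp [ω] at h4
  have hPQR : P ^ 2 = Q * R := by
    apply M.aeval_injective
    rw [map_pow, map_mul, hM, ← hPe, ← hRe]
    ring
  obtain ⟨g, p, q, hg, hcop, rfl, rfl⟩ := exists_isCoprime_factors P Q hQ0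
  have hq0 : q ≠ 0 := right_ne_zero_of_mul hQ0
  have h3 : g * p ^ 2 = q * R := by
    apply mul_left_cancel₀ hg
    linear_combination hPQR
  obtain ⟨t, rfl⟩ : q ∣ g := hcop.symm.pow_right.dvd_of_dvd_mul_right ⟨R, h3⟩
  have ht0 : t ≠ 0 := right_ne_zero_of_mul hg
  have h4 : t * p ^ 2 = R := by
    apply mul_left_cancel₀ hq0
    linear_combination h3
  refine ⟨p, q, ?_, ?_, hq0, ?_⟩
  · by_cases hp0 : p = 0
    · simp [hp0]
    have := hdeg R hR
    rw [← h4, natDegree_mul ht0 (pow_ne_zero 2 hp0), natDegree_pow] at this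
    omega
  · have := hdeg _ hQ
    rw [natDegree_mul hg hq0, natDegree_mul hq0 ht0] at this
    omega
  · apply mul_left_cancel₀ (M.aeval_ne_zero hg)
    simp only [map_mul] at hPe
    rw [hM, map_mul]
    linear_combination hPe

/-- A linear fractional function of `X` which is odd under `X ↦ -X` is a multiple of `X` or of
`X⁻¹`. -/
theorem eq_mul_X_or_eq_mul_inv_X {V : CurveField a b c h} (hV0 : V ≠ 0)
    (hV : negXAut a b c h V = -V) {p q : k[X]} (hp : p.natDegree ≤ 1) (hq : q.natDegree ≤ 1)
    (hq0 : q ≠ 0) (hpq : aeval (genX a b c h) q * V = aeval (genX a b c h) p) :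
    ∃ l : k, V = algebraMap k _ l * genX a b c h ∨ V = algebraMap k _ l * (genX a b c h)⁻¹ := by
  have h2 := two_ne_zero_of_Δ h
  have hx0 : genX a b c h ≠ 0 := (curveModel h).x_ne_zero
  obtain ⟨p₁, p₀, rfl⟩ := exists_eq_X_add_C_of_natDegree_le_one hp
  obtain ⟨q₁, q₀, rfl⟩ := exists_eq_X_add_C_of_natDegree_le_one hq
  have hpq' := congrArg (negXAut a b c h) hpq
  simp only [map_add, map_mul, aeval_C, aeval_X, hV, negXAut_genX, AlgEquiv.commutes] at hpq hpq'
  have h3 : aeval (genX a b c h) (C (p₀ * q₀) - C (p₁ * q₁) * X ^ 2) = 0 := by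
    simp only [map_sub, map_mul, map_pow, aeval_C, aeval_X]
    apply mul_left_cancel₀ (two_ne_zero_of_algebra _ h2)
    linear_combination (algebraMap k _ q₁ * genX a b c h - algebraMap k _ q₀) * hpq
      - (algebraMap k _ q₁ * genX a b c h + algebraMap k _ q₀) * hpq'
  have h4 : C (p₀ * q₀) - C (p₁ * q₁) * X ^ 2 = 0 :=
    (curveModel h).aeval_injective (h3.trans (map_zero _).symm)
  have e0 := congrArg (fun r => coeff r 0) h4
  have e2 := congrArg (fun r => coeff r 2) h4
  simp [-map_mul] at e0 e2
  have hinj : ∀ r : k, r ≠ 0 → algebraMap k (CurveField a b c h) r ≠ 0 := fun r hr =>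
    (_root_.map_ne_zero _).2 hr
  by_cases hq₀ : q₀ = 0
  · subst hq₀
    have hq₁ : q₁ ≠ 0 := by rintro rfl; simp at hq0
    have hp₁ : p₁ = 0 := e2.resolve_right hq₁
    subst hp₁
    have := hinj _ hq₁
    refine ⟨p₀ / q₁, Or.inr ?_⟩
    rw [map_div₀]
    field_simp
    simpa [mul_comm, mul_left_comm, mul_assoc] using hpq
  · have hp₀ : p₀ = 0 := e0.resolve_right hq₀
    subst hp₀
    have hp₁ : p₁ ≠ 0 := by
      rintro rfl
      simp only [map_zero, zero_mul, add_zero, mul_eq_zero, hV0, or_false] at hpq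
      refine (curveModel h).aeval_ne_zero hq0 ?_
      change aeval (genX a b c h) _ = 0
      simpa using hpq
    have hq₁ : q₁ = 0 := e2.resolve_left hp₁
    subst hq₁
    have := hinj _ hq₀
    refine ⟨p₁ / q₀, Or.inl ?_⟩
    rw [map_div₀]
    field_simp
    simpa [mul_comm] using hpq

/-- An element that the hyperelliptic involution negates has the form `s(X) Y`, so if its square is
a polynomial of degree at most `8` in `X`, then that polynomial is proportional to the octic. -/
theorem proportional_octic {U : CurveField a b c h} (hU : curveConj h U = -U)
    {g₈ g₆ g₄ g₂ g₀ : k} (hsq : U ^ 2 = aeval (genX a b c h)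
      (C g₈ * X ^ 8 + C g₆ * X ^ 6 + C g₄ * X ^ 4 + C g₂ * X ^ 2 + C g₀)) :
    g₆ = g₈ * a ∧ g₄ = g₈ * b ∧ g₂ = g₈ * c ∧ g₀ = g₈ := by
  have h2 := two_ne_zero_of_Δ h
  set G : k[X] := C g₈ * X ^ 8 + C g₆ * X ^ 6 + C g₄ * X ^ 4 + C g₂ * X ^ 2 + C g₀ with hG
  have hGdeg : G.natDegree ≤ 8 := by
    rw [hG]
    compute_degree
  set M := curveModel h
  have hM : M.x = genX a b c h := rfl
  have hMw : M.w = genY a b c h := rfl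
  have hMd : M.d = octic a b c := rfl
  have hUc : M.conj U = -U := hU
  obtain ⟨p, q, r, hr, hrep⟩ := M.exists_repr U
  have hc := congrArg M.conj hrep
  simp only [map_mul, map_add, M.conj_aeval, M.conj_w, hUc] at hc
  have hrU : aeval M.x r * U = aeval M.x q * M.w := by
    apply mul_left_cancel₀ (two_ne_zero_of_algebra _ h2)
    linear_combination hrep - hc
  -- `U = (q / r)(X) Y`, and `r` divides `q` because the octic is squarefree
  have hpoly : r ^ 2 * G = q ^ 2 * octic a b c := by
    apply M.aeval_injective
    rw [map_mul, map_mul, map_pow, map_pow, ← hMd, ← M.sq_w, hM, ← hsq, ← hM]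
    linear_combination (aeval M.x r * U + aeval M.x q * M.w) * hrU
  obtain ⟨s, rfl⟩ := dvd_of_sq_dvd_sq_mul_squarefree (squarefree_octic h) ⟨G, hpoly.symm⟩
  have hGs : G = s ^ 2 * octic a b c := by
    apply mul_left_cancel₀ (pow_ne_zero 2 hr)
    linear_combination hpoly
  have hs : s.natDegree = 0 := by
    by_cases hs0 : s = 0
    · simp [hs0]
    have hoct : (octic a b c).natDegree = 8 := by
      unfold octic
      compute_degree!
    rw [hGs, natDegree_mul (pow_ne_zero 2 hs0) (squarefree_octic h).ne_zero, natDegree_pow,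
      hoct] at hGdeg
    omega
  rw [eq_C_of_natDegree_eq_zero hs, ← C_pow] at hGs
  generalize s.coeff 0 ^ 2 = e at hGs
  rw [hG, octic] at hGs
  have e0 := congrArg (fun q => coeff q 0) hGs
  have e2 := congrArg (fun q => coeff q 2) hGs
  have e4 := congrArg (fun q => coeff q 4) hGs
  have e6 := congrArg (fun q => coeff q 6) hGs
  have e8 := congrArg (fun q => coeff q 8) hGs
  simp [coeff_one, coeff_C, coeff_X_pow] at e0 e2 e4 e6 e8
  subst e8
  exact ⟨e6, e4, e2, e0⟩

theorem exists_related_of_pairIso (hiso : PairIso (epsilon a b c h) (epsilon a' b' c' h')) :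
    ∃ m, Related a b c a' b' c' m := by
  obtain ⟨α, hα⟩ := hiso
  unfold epsilon at hα
  rw [reducedAutCongr_toReduced, eq_comm] at hα
  have hα' := (toReduced_eq_epsilon_iff h' _).1 hα
  simp only [AlgEquiv.trans_apply] at hα'
  set V := α.symm (genX a' b' c' h') with hVdef
  set W := α.symm (genY a' b' c' h') with hWdef
  have hV : negXAut a b c h V = -V := by
    apply α.injective
    rw [hα', map_neg, hVdef, AlgEquiv.apply_symm_apply]
  have hV0 : V ≠ 0 := (_root_.map_ne_zero α.symm).2 (curveModel h').x_ne_zero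
  have hWV : W ^ 2 = aeval V (octic a' b' c') := by
    have := aeval_algHom_apply
      (α.symm : CurveField a' b' c' h' →ₐ[k] CurveField a b c h) (genX a' b' c' h') (octic a' b' c')
    rw [← sq_genY, map_pow] at this
    exact this.symm
  have hW : curveConj h W = -W := by
    have h1 := (isHyperellipticInvolution_iff h').1
      (isHyperellipticInvolution_autCongr α (isHyperellipticInvolution_curveConj h))
    have h3 := DFunLike.congr_fun h1 (genY a' b' c' h')
    rw [curveConj_genY] at h3
    apply α.injective
    rw [map_neg, hWdef, AlgEquiv.apply_symm_apply]
    exact h3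
  have hx0 : genX a b c h ≠ 0 := (curveModel h).x_ne_zero
  obtain ⟨p, q, hp, hq, hq0, hpq⟩ := exists_linear_fraction h h' α.symm
  obtain ⟨l, hl | hl⟩ := eq_mul_X_or_eq_mul_inv_X h hV0 hV hp hq hq0 hpq
  · obtain ⟨e6, e4, e2, e0⟩ := proportional_octic h hW (g₈ := l ^ 8) (g₆ := a' * l ^ 6)
      (g₄ := b' * l ^ 4) (g₂ := c' * l ^ 2) (g₀ := 1) (by
        rw [hWV, aeval_octic, hl]
        simp only [map_add, map_mul, map_pow, aeval_C, aeval_X, map_one]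
        ring)
    rw [← e0, one_mul] at e6 e4 e2
    exact ⟨l ^ 2, by linear_combination -e0, by linear_combination e4,
      Or.inl ⟨by linear_combination e6, by linear_combination e2⟩⟩
  · obtain ⟨e6, e4, e2, e0⟩ := proportional_octic h (U := W * genX a b c h ^ 4) (by
        rw [map_mul, map_pow, hW, curveConj_genX, neg_mul])
      (g₈ := 1) (g₆ := c' * l ^ 2) (g₄ := b' * l ^ 4) (g₂ := a' * l ^ 6) (g₀ := l ^ 8) (by
        rw [mul_pow, hWV, aeval_octic, hl]
        simp only [map_add, map_mul, map_pow, aeval_C, aeval_X, map_one]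
        field_simp
        ring)
    exact ⟨l ^ 2, by linear_combination e0, by linear_combination e4,
      Or.inr ⟨by linear_combination e6, by linear_combination e2⟩⟩

/-- Generators `V, W` of `K_{a,b,c}` which satisfy the equation of `K_{a',b',c'}`, with `V` negated by
`X ↦ -X`, define an isomorphism of the pairs. -/
theorem pairIso_of_generators {V W : CurveField a b c h} (hVt : Transcendental k V)
    (hV : negXAut a b c h V = -V) (hW : W ^ 2 = aeval V (octic a' b' c'))
    (hx : ∀ F : IntermediateField k (CurveField a b c h), V ∈ F → W ∈ F →
      genX a b c h ∈ F ∧ genY a b c h ∈ F) :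
    PairIso (epsilon a b c h) (epsilon a' b' c' h') := by
  obtain ⟨φ, hφX, hφY⟩ := exists_curveField_algHom h' hVt hW
  have hsurj : Function.Surjective φ := by
    rw [← AlgHom.fieldRange_eq_top, eq_top_iff, ← (curveModel h).adjoin_eq_top,
      IntermediateField.adjoin_le_iff]
    obtain ⟨h1, h3⟩ := hx φ.fieldRange ⟨_, hφX⟩ ⟨_, hφY⟩
    rintro _ (rfl | rfl)
    exacts [h1, h3]
  let α := (AlgEquiv.ofBijective φ ⟨φ.injective, hsurj⟩).symm
  refine ⟨α, ?_⟩
  unfold epsilon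
  rw [reducedAutCongr_toReduced, eq_comm]
  refine (toReduced_eq_epsilon_iff h' _).2 ?_
  change α (negXAut a b c h (φ (genX a' b' c' h'))) = _
  rw [hφX, hV, map_neg, ← hφX]
  congr 1
  exact AlgEquiv.ofBijective_symm_apply_apply φ _ _

theorem pairIso_of_related {m : k} (hm : Related a b c a' b' c' m) :
    PairIso (epsilon a b c h) (epsilon a' b' c' h') := by
  obtain ⟨hm4, hb, hac⟩ := hm
  obtain ⟨l, hl⟩ := IsAlgClosed.exists_pow_nat_eq m two_pos
  subst hl
  have hl0 : l ≠ 0 := by rintro rfl; simp at hm4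
  set f := algebraMap k (CurveField a b c h)
  have hfl : f l ≠ 0 := (_root_.map_ne_zero _).2 hl0
  have hx0 : genX a b c h ≠ 0 := (curveModel h).x_ne_zero
  have hl8 : f l ^ 8 = 1 := by rw [← map_pow, ← map_one f]; congr 1; linear_combination hm4
  have hbf : f b = f b' * f l ^ 4 := by rw [← map_pow, ← map_mul]; congr 1; linear_combination -hb
  have hlF : ∀ F : IntermediateField k (CurveField a b c h), f l ∈ F := fun F => F.algebraMap_mem l
  rcases hac with ⟨ha, hc⟩ | ⟨ha, hc⟩
  · have haf : f a = f a' * f l ^ 6 := by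
      rw [← map_pow, ← map_mul]; congr 1; linear_combination -ha
    have hcf : f c = f c' * f l ^ 2 := by
      rw [← map_pow, ← map_mul]; congr 1; linear_combination -hc
    refine pairIso_of_generators h h' (V := f l * genX a b c h) (W := genY a b c h) ?_ ?_ ?_ ?_
    · intro halg
      refine transcendental_genX h ?_
      have := (isAlgebraic_algebraMap (R := k) (A := CurveField a b c h) l⁻¹).mul halg
      rwa [map_inv₀, inv_mul_cancel_left₀ hfl] at this
    · rw [map_mul, AlgEquiv.commutes, negXAut_genX, mul_neg]
    · rw [sq_genY, aeval_octic, aeval_octic]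
      change _ + f a * _ + f b * _ + f c * _ + _ = _ + f a' * _ + f b' * _ + f c' * _ + _
      rw [haf, hbf, hcf]
      linear_combination -(genX a b c h) ^ 8 * hl8
    · intro F hV hW
      refine ⟨?_, hW⟩
      have := F.mul_mem (F.inv_mem (hlF F)) hV
      rwa [inv_mul_cancel_left₀ hfl] at this
  · have haf : f a = f c' * f l ^ 2 := by
      rw [← map_pow, ← map_mul]; congr 1; linear_combination -ha
    have hcf : f c = f a' * f l ^ 6 := by
      rw [← map_pow, ← map_mul]; congr 1; linear_combination -hc
    refine pairIso_of_generators h h' (V := f l * (genX a b c h)⁻¹)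
      (W := genY a b c h * (genX a b c h)⁻¹ ^ 4) ?_ ?_ ?_ ?_
    · intro halg
      refine transcendental_genX h ?_
      have := (isAlgebraic_algebraMap (R := k) (A := CurveField a b c h) l⁻¹).mul halg
      rw [map_inv₀, inv_mul_cancel_left₀ hfl] at this
      simpa using this.inv
    · rw [map_mul, AlgEquiv.commutes, map_inv₀, negXAut_genX, inv_neg, mul_neg]
    · rw [mul_pow, sq_genY, aeval_octic, aeval_octic]
      change (_ + f a * _ + f b * _ + f c * _ + _) * _ = _ + f a' * _ + f b' * _ + f c' * _ + _
      rw [haf, hbf, hcf]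
      field_simp
      linear_combination -hl8
    · intro F hV hW
      have hX : genX a b c h ∈ F := by
        have := F.mul_mem (F.inv_mem (hlF F)) hV
        rw [inv_mul_cancel_left₀ hfl] at this
        simpa using F.inv_mem this
      refine ⟨hX, ?_⟩
      have := F.mul_mem hW (pow_mem hX 4)
      rwa [mul_assoc, ← mul_pow, inv_mul_cancel₀ hx0, one_pow, mul_one] at this

theorem pairIso_iff_exists_related :
    PairIso (epsilon a b c h) (epsilon a' b' c' h') ↔ ∃ m, Related a b c a' b' c' m :=
  ⟨exists_related_of_pairIso h h', fun ⟨_, hm⟩ => pairIso_of_related h h' hm⟩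

end Isomorphism

end DihedralInvariants

theorem mainTheorem7 {k : Type u} [Field k] [IsAlgClosed k] :
    -- the equation defines a hyperelliptic field `k(X, Y)` of genus 3, whose reduced automorphism
    -- group contains the non-hyperelliptic (indeed elliptic) involution `X ↦ -X`
    (∀ (a b c : k) (h : Δ a b c ≠ 0),
      (Transcendental k (genX a b c h) ∧
        genY a b c h ^ 2 = genX a b c h ^ 8 + algebraMap k (CurveField a b c h) a * genX a b c h ^ 6
          + algebraMap k (CurveField a b c h) b * genX a b c h ^ 4
          + algebraMap k (CurveField a b c h) c * genX a b c h ^ 2 + 1 ∧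
        IntermediateField.adjoin k {genX a b c h, genY a b c h} = ⊤) ∧
      IsHyperellipticField k (CurveField a b c h) ∧
      genus k (CurveField a b c h) = 3 ∧
      IsReducedEllipticInvolution (epsilon a b c h) ∧
      (∀ σ : CurveField a b c h ≃ₐ[k] CurveField a b c h,
        toReduced σ = epsilon a b c h ↔ σ (genX a b c h) = -genX a b c h)) ∧
    -- isomorphic pairs have the same dihedral invariants, and conversely
    -- if `𝔰₄ + 2 𝔰₂² ≠ 0`
    (∀ (a b c a' b' c' : k) (h : Δ a b c ≠ 0) (h' : Δ a' b' c' ≠ 0),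
      (PairIso (epsilon a b c h) (epsilon a' b' c' h') →
        s2 a b c = s2 a' b' c' ∧ s3 a b c = s3 a' b' c' ∧ s4 a b c = s4 a' b' c') ∧
      (s4 a b c + 2 * s2 a b c ^ 2 ≠ 0 →
        (PairIso (epsilon a b c h) (epsilon a' b' c' h') ↔
          s2 a b c = s2 a' b' c' ∧ s3 a b c = s3 a' b' c' ∧ s4 a b c = s4 a' b' c'))) := by
  refine ⟨fun a b c h => ⟨⟨transcendental_genX h, ?_, (curveModel h).adjoin_eq_top⟩,
    isHyperellipticField_curveField h, genus_curveField h, isReducedEllipticInvolution_epsilon h,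
    toReduced_eq_epsilon_iff h⟩, fun a b c a' b' c' h h' => ?_⟩
  · rw [sq_genY, aeval_octic]
  · have key : PairIso (epsilon a b c h) (epsilon a' b' c' h') →
        s2 a b c = s2 a' b' c' ∧ s3 a b c = s3 a' b' c' ∧ s4 a b c = s4 a' b' c' := fun hiso => by
      obtain ⟨m, hm⟩ := (pairIso_iff_exists_related h h').1 hiso
      exact hm.invariants_eq
    refine ⟨key, fun hne => ⟨key, fun ⟨e2, e3, e4⟩ => ?_⟩⟩
    exact (pairIso_iff_exists_related h h').2
      (exists_related_of_invariants_eq (two_ne_zero_of_Δ h) hne e2 e3 e4)
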